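/- Let $n\ge 0$, let $\mathcal O=\mathbb C\{x_1,\dots,x_n\}$ be the ring of convergent power series, $\mathfrak m=\langle x_1,\dots,x_n\rangle$ its maximal ideal, $\widehat{\mathcal O}=\mathbb C[[x_1,\dots,x_n]]$ the ring of formal power series and $\widehat{\mathfrak m}$ its maximal ideal. Let $\mathrm{Der}$ and $\widehat{\mathrm{Der}}$ be the modules of $\mathbb C$-derivations of $\mathcal O$ and of $\widehat{\mathcal O}$, respectively. For $f\in\mathcal O$, let $\mathrm{Der}_f=\{\delta\in\mathrm{Der} : \delta(f)\in\mathcal O f\}$ be the $\mathcal O$-module of logarithmic derivations for $f$, and let $\widehat{\mathrm{Der}}_f=\{\delta\in\widehat{\mathrm{Der}} : \delta(f)\in\widehat{\mathcal O} f\}$ be the $\widehat{\mathcal O}$-module of formal logarithmic derivations for $f$ (the $\mathfrak m$-adic completion of $\mathrm{Der}_f$). A series $f\in\mathcal O$ is called free if it is reduced (nonzero, without repeated factors) and $\mathrm{Der}_f$ is a free $\mathcal O$-module. A $\mathbb C$-linear map $T:\widehat{\mathcal O}\to\widehat{\mathcal O}$ with $T(\widehat{\mathfrak m}^k)\subseteq\widehat{\mathfrak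 m}^k$ for all $k$ is called semisimple if every $T$-stable linear subspace $H\subseteq\widehat{\mathcal O}$ that is closed in the $\widehat{\mathfrak m}$-adic topology admits a $T$-stable linear subspace $H'$ with $\widehat{\mathcal O}=H\oplus H'$; it is called (topologically) nilpotent if for every $g\in\widehat{\mathcal O}$ the sequence $T^m(g)$ tends to $0$ in the $\widehat{\mathfrak m}$-adic topology. Suppose that $f\in\mathcal O$ is free and that $\mathrm{Der}_f\subseteq\mathfrak m\,\mathrm{Der}$ (that is, every logarithmic derivation for $f$ is singular). Then there is an $\widehat{\mathcal O}$-basis $\delta_1,\dots,\delta_n$ of $\widehat{\mathrm{Der}}_f$ such that each $\delta_i$ is semisimple or nilpotent. Moreover, there is a unit $u\in\widehat{\mathcal O}$ with $f=u\cdot\det(A)$, where $A=(\delta_i(x_j))_{i,j}$ is the Saito matrix of this basis. -/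

import Mathlib

namespace FreeDiv

/-- The ring `ℂ[[x₁, …, xₙ]]` of formal power series. -/
abbrev FormalRing (n : ℕ) : Type := MvPowerSeries (Fin n) ℂ

/-- A formal power series converges near the origin if it converges absolutely on some polydisc
of positive radius. -/
def IsConvergent {n : ℕ} (f : FormalRing n) : Prop :=
  ∃ r : ℝ, 0 < r ∧
    Summable (fun d : Fin n →₀ ℕ => ‖MvPowerSeries.coeff d f‖ * r ^ d.degree)

theorem summable_of_le {n : ℕ} {f : FormalRing n} {r s : ℝ} (hs : 0 < s) (hsr : s ≤ r)
    (h : Summable (fun d : Fin n →₀ ℕ => ‖MvPowerSeries.coeff d f‖ * r ^ d.degree)) :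
    Summable (fun d : Fin n →₀ ℕ => ‖MvPowerSeries.coeff d f‖ * s ^ d.degree) := by
  refine Summable.of_nonneg_of_le (fun d => by positivity) (fun d => ?_) h
  gcongr

theorem isConvergent_monomial {n : ℕ} (e : Fin n →₀ ℕ) (a : ℂ) :
    IsConvergent (MvPowerSeries.monomial e a : FormalRing n) := by
  classical
  refine ⟨1, one_pos, summable_of_ne_finset_zero (s := {e}) fun d hd => ?_⟩
  rw [MvPowerSeries.coeff_monomial_ne (by simpa using hd)]
  simp

theorem IsConvergent.add {n : ℕ} {f g : FormalRing n} (hf : IsConvergent f)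
    (hg : IsConvergent g) : IsConvergent (f + g) := by
  obtain ⟨r, hr, hf⟩ := hf
  obtain ⟨s, hs, hg⟩ := hg
  have ht : 0 < min r s := lt_min hr hs
  refine ⟨min r s, ht, Summable.of_nonneg_of_le (fun d => by positivity) (fun d => ?_)
    ((summable_of_le ht (min_le_left r s) hf).add (summable_of_le ht (min_le_right r s) hg))⟩
  rw [map_add, ← add_mul]
  gcongr
  exact norm_add_le _ _

theorem summable_antidiagonal {M : Type*} [AddCommMonoid M] [Finset.HasAntidiagonal M]
    {F G : M → ℝ} (hF : Summable F) (hG : Summable G) (hF0 : 0 ≤ F) (hG0 : 0 ≤ G) :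
    Summable fun d => ∑ p ∈ Finset.HasAntidiagonal.antidiagonal d, F p.1 * G p.2 :=
  summable_sum_mul_antidiagonal_of_summable_mul (hF.mul_of_nonneg hG hF0 hG0)

theorem norm_coeff_mul_le {n : ℕ} (f g : FormalRing n) {t : ℝ} (ht : 0 < t) (d : Fin n →₀ ℕ) :
    ‖MvPowerSeries.coeff d (f * g)‖ * t ^ d.degree ≤
      ∑ p ∈ Finset.HasAntidiagonal.antidiagonal d, (‖MvPowerSeries.coeff p.1 f‖ * t ^ p.1.degree) *
        (‖MvPowerSeries.coeff p.2 g‖ * t ^ p.2.degree) := by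
  rw [MvPowerSeries.coeff_mul]
  refine (mul_le_mul_of_nonneg_right (norm_sum_le _ _) (pow_nonneg ht.le _)).trans (le_of_eq ?_)
  rw [Finset.sum_mul]
  refine Finset.sum_congr rfl fun p hp => ?_
  rw [← Finset.HasAntidiagonal.mem_antidiagonal.mp hp, map_add, pow_add, norm_mul, mul_mul_mul_comm]

theorem IsConvergent.mul {n : ℕ} {f g : FormalRing n} (hf : IsConvergent f)
    (hg : IsConvergent g) : IsConvergent (f * g) := by
  obtain ⟨r, hr, hf⟩ := hf
  obtain ⟨s, hs, hg⟩ := hg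
  have ht : 0 < min r s := lt_min hr hs
  have hF := summable_of_le ht (min_le_left r s) hf
  have hG := summable_of_le ht (min_le_right r s) hg
  generalize min r s = t at ht hF hG
  have h := summable_antidiagonal hF hG
    (fun d => mul_nonneg (norm_nonneg _) (pow_nonneg ht.le _))
    (fun d => mul_nonneg (norm_nonneg _) (pow_nonneg ht.le _))
  exact ⟨t, ht, Summable.of_nonneg_of_le
    (fun d => mul_nonneg (norm_nonneg _) (pow_nonneg ht.le _))
    (norm_coeff_mul_le f g ht) h⟩

/-- The ring `ℂ{x₁, …, xₙ}` of convergent power series, inside `ℂ[[x₁, …, xₙ]]`. -/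
def ConvergentRing (n : ℕ) : Subalgebra ℂ (FormalRing n) where
  carrier := {f | IsConvergent f}
  mul_mem' := IsConvergent.mul
  add_mem' := IsConvergent.add
  algebraMap_mem' a := by
    have h := isConvergent_monomial (n := n) 0 a
    rwa [MvPowerSeries.monomial_zero_eq_C_apply] at h

/-- The coordinate `xᵢ` as a convergent power series. -/
noncomputable def convergentX {n : ℕ} (i : Fin n) : ConvergentRing n :=
  ⟨MvPowerSeries.X i, isConvergent_monomial (Finsupp.single i 1) 1⟩

/-- The maximal ideal `⟨x₁, …, xₙ⟩` of `ℂ{x₁, …, xₙ}`. -/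
noncomputable def convergentMaxIdeal (n : ℕ) : Ideal (ConvergentRing n) :=
  Ideal.span (Set.range convergentX)

/-- The maximal ideal `⟨x₁, …, xₙ⟩` of `ℂ[[x₁, …, xₙ]]`. -/
noncomputable def formalMaxIdeal (n : ℕ) : Ideal (FormalRing n) :=
  Ideal.span (Set.range fun i : Fin n => MvPowerSeries.X i)

/-- The `A`-module of logarithmic derivations for `f ∈ A`: the `ℂ`-derivations `δ` of `A` such
that `δ f` is a multiple of `f`. -/
def logDer {A : Type} [CommRing A] [Algebra ℂ A] (f : A) : Submodule A (Derivation ℂ A A) where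
  carrier := {δ | δ f ∈ Ideal.span {f}}
  add_mem' {δ ε} hδ hε := by
    simp only [Set.mem_ofPred_eq] at hδ hε ⊢
    exact Ideal.add_mem _ hδ hε
  zero_mem' := by
    simp only [Set.mem_ofPred_eq, Derivation.zero_apply]
    exact Ideal.zero_mem _
  smul_mem' a δ hδ := by
    simp only [Set.mem_ofPred_eq] at hδ ⊢
    exact Ideal.mul_mem_left _ a hδ

/-- A convergent power series is free if it is reduced (no repeated factors; in particular it is
nonzero) and its module of logarithmic derivations is a free module over `ℂ{x₁, …, xₙ}`. -/
def IsFreeSeries {n : ℕ} (f : ConvergentRing n) : Prop :=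
  Squarefree f ∧ Module.Free (ConvergentRing n) (logDer f)

/-- The linear maps `T` of `ℂ[[x₁, …, xₙ]]` that preserve the filtration by the powers of the
maximal ideal `𝔪`: `T (𝔪 ^ k) ⊆ 𝔪 ^ k` for every `k`. -/
def IsFiltered {n : ℕ} (T : Module.End ℂ (FormalRing n)) : Prop :=
  ∀ k : ℕ, ∀ g ∈ formalMaxIdeal n ^ k, T g ∈ formalMaxIdeal n ^ k

/-- `T` is semisimple: every linear subspace that is closed in the `𝔪`-adic topology and stable
by `T` has a supplementary linear subspace that is also stable by `T`. -/
def IsSemisimpleMap {n : ℕ} (T : Module.End ℂ (FormalRing n)) : Prop :=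
  IsFiltered T ∧
    ∀ H : Submodule ℂ (FormalRing n),
      @IsClosed (FormalRing n) (formalMaxIdeal n).adicTopology (H : Set (FormalRing n)) →
      (∀ g ∈ H, T g ∈ H) →
      ∃ H' : Submodule ℂ (FormalRing n), IsCompl H H' ∧ ∀ g ∈ H', T g ∈ H'

/-- `T` is topologically nilpotent: for every `g`, the sequence `T ^ m g` tends to `0` in the
`𝔪`-adic topology. -/
def IsTopNilpotentMap {n : ℕ} (T : Module.End ℂ (FormalRing n)) : Prop :=
  IsFiltered T ∧
    ∀ g : FormalRing n, ∀ k : ℕ, ∃ m₀ : ℕ, ∀ m : ℕ, m₀ ≤ m → (T ^ m) g ∈ formalMaxIdeal n ^ k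

/-- The Saito matrix `(δᵢ(xⱼ))ᵢⱼ` of a family of formal derivations. -/
noncomputable def saitoMatrix {n : ℕ} (δ : Fin n → Derivation ℂ (FormalRing n) (FormalRing n)) :
    Matrix (Fin n) (Fin n) (FormalRing n) :=
  Matrix.of fun i j => δ i (MvPowerSeries.X j)

end FreeDiv

/-!
A formal derivation `D` that vanishes at the origin has a Jordan decomposition `D = S + N` into a
semisimple and a nilpotent derivation (`exists_formal_jordan`). Indeed `D` acts on the finite
dimensional algebras of jets `ℂ[[x]] / 𝔪 ^ k`, and the semisimple part of a derivation of a finite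
dimensional algebra is a derivation (`semisimplePart_leibniz`); by the uniqueness of Jordan
decompositions these parts are compatible and have a limit `S`. On jets `S` is a polynomial in `D`,
so `S` preserves the closed subspaces that `D` preserves. As ideals of `ℂ[[x]]` are closed, `S` and
`N` are logarithmic for `f` if `D` is (`exists_semisimple_add_nilpotent`).

That `S` is semisimple in the topological sense is shown on the space of continuous linear forms,
which is the union of the duals of the spaces of jets. There the transpose of `S` is semisimple in
the algebraic sense, being so on each of these finite dimensional subspaces
(`isSemisimple_transposeMap`), and orthogonality exchanges closed stable subspaces of `ℂ[[x]]` and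
stable subspaces of the continuous dual (`isSemisimpleMap_of_transposeMap`).

Let `δ₁, …, δₙ` be a basis of the convergent logarithmic derivations. By the lemma of Artin and Rees
it generates the formal ones (`span_formalExtension`), and by the criterion of Saito its determinant
is `f` up to a unit (`associated_det_convergentSaitoMatrix`); since `f ≠ 0`, it is a basis of the
formal logarithmic derivations. The semisimple and nilpotent parts of the `δᵢ` generate this free
module over a local ring, so by the lemma of Nakayama `n` of them form a basis
(`exists_basis_of_span_eq_top_of_isLocalRing`). Changing the basis multiplies the determinant by a
unit.

Both Artin–Rees and the criterion of Saito require commutative algebra of `ℂ{x₁, …, xₙ}`, namely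
that it is Noetherian and factorial. This is proved by induction on the number of variables through
Weierstrass division (`exists_weierstrass_division`), whose quotient is the solution of a
contractive equation (`exists_eq_add_of_raises_weight`).
-/


namespace FreeDiv

open MvPowerSeries Finset
open scoped ENNReal NNReal

/-! ### Weighted norms of power series -/

/-- The monomial `ρ ^ d = ∏ ρᵢ ^ dᵢ` in the radii of a polydisc. -/
noncomputable def radiusMonomial {n : ℕ} (ρ : Fin n → ℝ≥0) (d : Fin n →₀ ℕ) : ℝ≥0 := ∏ i, ρ i ^ d i

theorem radiusMonomial_add {n : ℕ} (ρ : Fin n → ℝ≥0) (d e : Fin n →₀ ℕ) :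
    radiusMonomial ρ (d + e) = radiusMonomial ρ d * radiusMonomial ρ e := by
  simp [radiusMonomial, pow_add, prod_mul_distrib]

theorem radiusMonomial_mono {n : ℕ} {ρ τ : Fin n → ℝ≥0} (h : ρ ≤ τ) (d : Fin n →₀ ℕ) :
    radiusMonomial ρ d ≤ radiusMonomial τ d :=
  prod_le_prod' fun i _ => pow_le_pow_left' (h i) _

theorem radiusMonomial_const {n : ℕ} (r : ℝ≥0) (d : Fin n →₀ ℕ) :
    radiusMonomial (fun _ => r) d = r ^ d.degree := by
  rw [radiusMonomial, prod_pow_eq_pow_sum, Finsupp.degree_eq_sum]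

theorem radiusMonomial_single {n : ℕ} (ρ : Fin n → ℝ≥0) (t : Fin n) (k : ℕ) :
    radiusMonomial ρ (Finsupp.single t k) = ρ t ^ k := by
  classical
  rw [radiusMonomial, prod_eq_single t]
  · simp
  · intro i _ hi
    simp [Finsupp.single_eq_of_ne hi]
  · simp

/-- The norm `∑ |f_d| ρ ^ d` of a power series on the polydisc of polyradius `ρ`; it is infinite
if the series does not converge absolutely there. -/
noncomputable def polydiscNorm {n : ℕ} (ρ : Fin n → ℝ≥0) (f : FormalRing n) : ℝ≥0∞ :=
  ∑' d, ‖coeff d f‖ₑ * radiusMonomial ρ d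

theorem polydiscNorm_mono {n : ℕ} {ρ τ : Fin n → ℝ≥0} (h : ρ ≤ τ) (f : FormalRing n) :
    polydiscNorm ρ f ≤ polydiscNorm τ f :=
  ENNReal.tsum_le_tsum fun d => by
    gcongr
    exact radiusMonomial_mono h d

theorem polydiscNorm_add_le {n : ℕ} (ρ : Fin n → ℝ≥0) (f g : FormalRing n) :
    polydiscNorm ρ (f + g) ≤ polydiscNorm ρ f + polydiscNorm ρ g := by
  rw [polydiscNorm, polydiscNorm, polydiscNorm, ← ENNReal.tsum_add]
  refine ENNReal.tsum_le_tsum fun d => ?_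
  rw [map_add, ← add_mul]
  gcongr
  exact enorm_add_le _ _

theorem polydiscNorm_neg {n : ℕ} (ρ : Fin n → ℝ≥0) (f : FormalRing n) :
    polydiscNorm ρ (-f) = polydiscNorm ρ f := by
  simp [polydiscNorm]

theorem polydiscNorm_le_of_coeff_le {n : ℕ} (ρ : Fin n → ℝ≥0) {f g : FormalRing n}
    (h : ∀ d, ‖coeff d f‖ₑ ≤ ‖coeff d g‖ₑ) : polydiscNorm ρ f ≤ polydiscNorm ρ g :=
  ENNReal.tsum_le_tsum fun d => by gcongr; exact h d

theorem ENNReal_tsum_antidiagonal {M : Type*} [AddCommMonoid M] [HasAntidiagonal M]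
    (F G : M → ℝ≥0∞) :
    ∑' d, ∑ p ∈ antidiagonal d, F p.1 * G p.2 = (∑' d, F d) * ∑' d, G d := by
  have h1 : (∑' d, F d) * ∑' d, G d = ∑' p : M × M, F p.1 * G p.2 := by
    rw [ENNReal.tsum_prod (f := fun a b => F a * G b)]
    simp_rw [ENNReal.tsum_mul_left, ENNReal.tsum_mul_right]
  rw [h1, ← HasAntidiagonal.sigmaAntidiagonalEquivProd.tsum_eq, ENNReal.tsum_sigma']
  refine tsum_congr fun d => ?_
  rw [tsum_fintype, ← Finset.sum_coe_sort]
  rfl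

theorem polydiscNorm_mul_le {n : ℕ} (ρ : Fin n → ℝ≥0) (f g : FormalRing n) :
    polydiscNorm ρ (f * g) ≤ polydiscNorm ρ f * polydiscNorm ρ g := by
  rw [polydiscNorm, polydiscNorm, polydiscNorm, ← ENNReal_tsum_antidiagonal]
  refine ENNReal.tsum_le_tsum fun d => ?_
  rw [coeff_mul]
  refine (mul_le_mul_left (enorm_sum_le _ _) _).trans ?_
  rw [Finset.sum_mul]
  refine Finset.sum_le_sum fun p hp => ?_
  rw [← mem_antidiagonal.mp hp, radiusMonomial_add, enorm_mul, ENNReal.coe_mul, mul_mul_mul_comm]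

theorem polydiscNorm_monomial {n : ℕ} (ρ : Fin n → ℝ≥0) (e : Fin n →₀ ℕ) (a : ℂ) :
    polydiscNorm ρ (monomial e a : FormalRing n) = ‖a‖ₑ * radiusMonomial ρ e := by
  classical
  rw [polydiscNorm, tsum_eq_single e]
  · simp
  · intro d hd
    simp [coeff_monomial_ne hd]

theorem polydiscNorm_pow_le {n : ℕ} (ρ : Fin n → ℝ≥0) (f : FormalRing n) (k : ℕ) :
    polydiscNorm ρ (f ^ k) ≤ polydiscNorm ρ f ^ k := by
  induction k with
  | zero =>
    have := polydiscNorm_monomial ρ 0 1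
    rw [monomial_zero_one] at this
    simp [this, radiusMonomial]
  | succ k ih =>
    rw [pow_succ, pow_succ]
    exact (polydiscNorm_mul_le _ _ _).trans (by gcongr)

theorem polydiscNorm_prod_le {n : ℕ} (ρ : Fin n → ℝ≥0) {ι : Type*} (s : Finset ι)
    (f : ι → FormalRing n) :
    polydiscNorm ρ (∏ i ∈ s, f i) ≤ ∏ i ∈ s, polydiscNorm ρ (f i) := by
  classical
  induction s using Finset.induction_on with
  | empty =>
    have := polydiscNorm_pow_le ρ 1 0
    simpa using this
  | insert i s hi ih =>
    rw [prod_insert hi, prod_insert hi]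
    exact (polydiscNorm_mul_le _ _ _).trans (by gcongr)

theorem isConvergent_iff_polydiscNorm {n : ℕ} (f : FormalRing n) :
    IsConvergent f ↔ ∃ r : ℝ≥0, 0 < r ∧ polydiscNorm (fun _ => r) f ≠ ⊤ := by
  have key : ∀ r : ℝ≥0, polydiscNorm (fun _ => r) f ≠ ⊤ ↔
      Summable (fun d : Fin n →₀ ℕ => ‖coeff d f‖ * (r : ℝ) ^ d.degree) := by
    intro r
    have : polydiscNorm (fun _ => r) f =
        ∑' d, ((‖coeff d f‖₊ * r ^ d.degree : ℝ≥0) : ℝ≥0∞) := by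
      simp [polydiscNorm, radiusMonomial_const, enorm_eq_nnnorm]
    rw [this, ENNReal.tsum_coe_ne_top_iff_summable, ← NNReal.summable_coe]
    simp
  constructor
  · rintro ⟨r, hr, h⟩
    exact ⟨⟨r, hr.le⟩, hr, (key _).2 h⟩
  · rintro ⟨r, hr, h⟩
    exact ⟨r, hr, (key r).1 h⟩

theorem isConvergent_of_polydiscNorm {n : ℕ} {ρ : Fin n → ℝ≥0} (hρ : ∀ i, 0 < ρ i)
    {f : FormalRing n} (h : polydiscNorm ρ f ≠ ⊤) : IsConvergent f := by
  rw [isConvergent_iff_polydiscNorm]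
  obtain ⟨r, hr, hr'⟩ : ∃ r : ℝ≥0, 0 < r ∧ ∀ i, r ≤ ρ i := by
    rcases isEmpty_or_nonempty (Fin n) with hn | hn
    · exact ⟨1, one_pos, fun i => isEmptyElim i⟩
    · obtain ⟨i, hi⟩ := Finite.exists_min ρ
      exact ⟨ρ i, hρ i, hi⟩
  exact ⟨r, hr, ne_top_of_le_ne_top h (polydiscNorm_mono hr' f)⟩

/-! ### Solving contractive equations in the ring of convergent power series -/

/-- If an additive operator `L` strictly raises a weight of exponents, the equation
`q = h + L q` has a solution. The solution inherits the support of `h`, and it converges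
wherever `h` does and `L` contracts the norm by a factor `1/2`. -/
theorem exists_eq_add_of_raises_weight {n : ℕ} (w : (Fin n →₀ ℕ) → ℕ)
    (L : FormalRing n →+ FormalRing n)
    (hL : ∀ k q, (∀ d, w d < k → coeff d q = 0) → ∀ d, w d < k + 1 → coeff d (L q) = 0)
    (h : FormalRing n) :
    ∃ q, q = h + L q ∧
      (∀ ρ, (∀ p, polydiscNorm ρ (L p) ≤ 2⁻¹ * polydiscNorm ρ p) →
        polydiscNorm ρ q ≤ 2 * polydiscNorm ρ h) ∧
      (∀ P : (Fin n →₀ ℕ) → Prop, (∀ d, ¬ P d → coeff d h = 0) →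
        (∀ p, (∀ d, ¬ P d → coeff d p = 0) → ∀ d, ¬ P d → coeff d (L p) = 0) →
        ∀ d, ¬ P d → coeff d q = 0) := by
  obtain ⟨it, it0, its⟩ : ∃ it : ℕ → FormalRing n, it 0 = 0 ∧ ∀ k, it (k + 1) = h + L (it k) :=
    ⟨fun k => Nat.rec 0 (fun _ q => h + L q) k, rfl, fun k => rfl⟩
  -- Consecutive iterates agree in weights below their index.
  have hdiff : ∀ k d, w d < k → coeff d (it (k + 1) - it k) = 0 := by
    intro k
    induction k with
    | zero => simp
    | succ k ih =>
      intro d hd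
      rw [its (k + 1), its k, add_sub_add_left_eq_sub, ← map_sub L, ← its k]
      exact hL k _ ih d hd
  have hstab : ∀ d k, w d < k → coeff d (it k) = coeff d (it (w d + 1)) := by
    intro d k hk
    induction k, hk using Nat.le_induction with
    | base => rfl
    | succ k hk ih =>
      rw [← ih, ← sub_eq_zero, ← map_sub]
      exact hdiff k d hk
  obtain ⟨q, hq⟩ : ∃ q : FormalRing n, ∀ d, coeff d q = coeff d (it (w d + 1)) :=
    ⟨fun d => coeff d (it (w d + 1)), fun d => rfl⟩
  have hqk : ∀ k d, w d < k → coeff d (q - it k) = 0 := by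
    intro k d hd
    rw [map_sub, hq, hstab d k hd, sub_self]
  refine ⟨q, ?_, ?_, ?_⟩
  · ext d
    have h1 := hqk (w d + 2) d (by omega)
    have h2 := hL (w d + 1) _ (hqk (w d + 1)) d (by omega)
    rw [its (w d + 1), map_sub, sub_eq_zero] at h1
    rw [map_sub L, map_sub, sub_eq_zero] at h2
    rw [h1, map_add, map_add, h2]
  · intro ρ hρ
    have hb : ∀ k, polydiscNorm ρ (it k) ≤ 2 * polydiscNorm ρ h := by
      intro k
      induction k with
      | zero => simp [it0, polydiscNorm]
      | succ k ih =>
        rw [its]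
        refine (polydiscNorm_add_le _ _ _).trans ?_
        calc _ ≤ polydiscNorm ρ h + 2⁻¹ * (2 * polydiscNorm ρ h) := by
              gcongr
              exact (hρ _).trans (by gcongr)
          _ = _ := by
              rw [← mul_assoc, ENNReal.inv_mul_cancel (by simp) (by simp), one_mul, two_mul]
    rw [polydiscNorm, ENNReal.tsum_eq_iSup_sum]
    refine iSup_le fun s => ?_
    -- A finite partial sum of the norm of `q` is one of a late enough iterate.
    have : ∑ d ∈ s, ‖coeff d q‖ₑ * (radiusMonomial ρ d : ℝ≥0∞) =
        ∑ d ∈ s, ‖coeff d (it (s.sup w + 1))‖ₑ * (radiusMonomial ρ d : ℝ≥0∞) := by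
      refine sum_congr rfl fun d hd => ?_
      rw [hq, hstab d (s.sup w + 1) (Nat.lt_succ_of_le (le_sup (f := w) hd))]
    rw [this]
    exact (ENNReal.sum_le_tsum s).trans (hb _)
  · intro P hP hLP d hd
    have : ∀ k d, ¬ P d → coeff d (it k) = 0 := by
      intro k
      induction k with
      | zero => simp [it0]
      | succ k ih =>
        intro d hd
        rw [its, map_add, hP d hd, hLP _ ih d hd, add_zero]
    rw [hq]
    exact this (w d + 1) d hd

/-- An additive operator that strictly raises a weight of exponents has no nonzero fixed point. -/
theorem eq_zero_of_raises_weight {n : ℕ} (w : (Fin n →₀ ℕ) → ℕ)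
    (L : FormalRing n → FormalRing n)
    (hL : ∀ k q, (∀ d, w d < k → coeff d q = 0) → ∀ d, w d < k + 1 → coeff d (L q) = 0)
    {q : FormalRing n} (hq : q = L q) : q = 0 := by
  have : ∀ k d, w d < k → coeff d q = 0 := by
    intro k
    induction k with
    | zero => simp
    | succ k ih =>
      intro d hd
      rw [hq]
      exact hL k q ih d hd
  ext d
  exact this (w d + 1) d (by omega)

theorem coeff_mul_eq_zero_of_weight {n : ℕ} {w : (Fin n →₀ ℕ) → ℕ}
    (hw : ∀ a b, w (a + b) = w a + w b) {f g : FormalRing n} {k l : ℕ}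
    (hf : ∀ d, w d < k → coeff d f = 0) (hg : ∀ d, w d < l → coeff d g = 0)
    (d : Fin n →₀ ℕ) (hd : w d < k + l) : coeff d (f * g) = 0 := by
  rw [coeff_mul]
  refine sum_eq_zero fun p hp => ?_
  have := hw p.1 p.2
  rw [mem_antidiagonal.mp hp] at this
  by_cases h : w p.1 < k
  · rw [hf _ h, zero_mul]
  · rw [hg _ (by omega), mul_zero]

/-! ### Convergent power series in a subset of the variables -/

/-- The formal power series in the variables `xᵢ` with `i ∈ s`. -/
noncomputable def supportedIn {n : ℕ} (s : Finset (Fin n)) : Subalgebra ℂ (FormalRing n) where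
  carrier := {f | ∀ d : Fin n →₀ ℕ, ¬ d.support ⊆ s → coeff d f = 0}
  mul_mem' {f g} hf hg d hd := by
    classical
    rw [coeff_mul]
    refine sum_eq_zero fun p hp => ?_
    by_cases h1 : p.1.support ⊆ s
    · by_cases h2 : p.2.support ⊆ s
      · refine absurd ?_ hd
        rw [← mem_antidiagonal.mp hp]
        exact Finsupp.support_add.trans (union_subset h1 h2)
      · rw [hg _ h2, mul_zero]
    · rw [hf _ h1, zero_mul]
  add_mem' {f g} hf hg d hd := by rw [map_add, hf d hd, hg d hd, add_zero]
  algebraMap_mem' a d hd := by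
    classical
    rw [MvPowerSeries.algebraMap_apply, coeff_C, if_neg]
    rintro rfl
    simp at hd

/-- The ring `ℂ{xᵢ : i ∈ s}` of convergent power series in the variables with index in `s`. -/
noncomputable def convergentIn {n : ℕ} (s : Finset (Fin n)) : Subalgebra ℂ (FormalRing n) :=
  ConvergentRing n ⊓ supportedIn s

theorem convergentIn_mono {n : ℕ} {s s' : Finset (Fin n)} (h : s' ⊆ s) :
    convergentIn s' ≤ convergentIn s :=
  fun _ hf => ⟨hf.1, fun d hd => hf.2 d fun h' => hd (h'.trans h)⟩

theorem convergentIn_univ (n : ℕ) : convergentIn (univ : Finset (Fin n)) = ConvergentRing n := by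
  ext f
  exact ⟨fun h => h.1, fun h => ⟨h, fun d hd => absurd (subset_univ _) hd⟩⟩

theorem X_mem_convergentIn {n : ℕ} {s : Finset (Fin n)} {t : Fin n} (ht : t ∈ s) :
    (X t : FormalRing n) ∈ convergentIn s := by
  classical
  refine ⟨isConvergent_monomial (Finsupp.single t 1) 1, fun d hd => ?_⟩
  rw [coeff_X, if_neg]
  rintro rfl
  exact hd (Finsupp.support_single_subset.trans (by simpa using ht))

/-- Shrinking the radii of the variables in `T` makes the norm of a series small, if all its
monomials involve a variable of `T`. -/
theorem exists_polydiscNorm_le {n : ℕ} (T : Finset (Fin n)) {v : FormalRing n}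
    (hv : ∀ d, ∑ i ∈ T, d i < 1 → coeff d v = 0) {ρ : Fin n → ℝ≥0} (hρ : ∀ i, 0 < ρ i)
    (hfin : polydiscNorm ρ v ≠ ⊤) {δ : ℝ≥0} (hδ : 0 < δ) :
    ∃ τ : Fin n → ℝ≥0, (∀ i, 0 < τ i) ∧ τ ≤ ρ ∧ (∀ i, i ∉ T → τ i = ρ i) ∧
      polydiscNorm τ v ≤ δ := by
  classical
  lift polydiscNorm ρ v to ℝ≥0 using hfin with N hN
  let ε : ℝ≥0 := min 1 (δ / (N + 1))
  have hε : 0 < ε := lt_min one_pos (div_pos hδ (by positivity))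
  have hε1 : ε ≤ 1 := min_le_left _ _
  refine ⟨fun i => if i ∈ T then ε * ρ i else ρ i, fun i => ?_, fun i => ?_, fun i hi => ?_, ?_⟩
  · dsimp only
    split_ifs
    exacts [mul_pos hε (hρ i), hρ i]
  · dsimp only
    split_ifs
    exacts [mul_le_of_le_one_left' hε1, le_rfl]
  · simp [hi]
  · have hmon : ∀ d : Fin n →₀ ℕ, radiusMonomial (fun i => if i ∈ T then ε * ρ i else ρ i) d =
        ε ^ (∑ i ∈ T, d i) * radiusMonomial ρ d := by
      intro d
      have h1 : ε ^ (∑ i ∈ T, d i) = ∏ i, if i ∈ T then ε ^ d i else 1 := by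
        rw [prod_ite_mem, univ_inter, prod_pow_eq_pow_sum]
      rw [radiusMonomial, radiusMonomial, h1, ← prod_mul_distrib]
      refine prod_congr rfl fun i _ => ?_
      split_ifs <;> simp [mul_pow]
    have hle : polydiscNorm (fun i => if i ∈ T then ε * ρ i else ρ i) v ≤ ε * polydiscNorm ρ v := by
      rw [polydiscNorm, polydiscNorm, ← ENNReal.tsum_mul_left]
      refine ENNReal.tsum_le_tsum fun d => ?_
      by_cases hd : ∑ i ∈ T, d i < 1
      · simp [hv d hd]
      · rw [hmon, mul_left_comm, ← ENNReal.coe_mul]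
        gcongr
        exact pow_le_of_le_one zero_le hε1 (by omega)
    refine hle.trans ?_
    rw [← hN, ← ENNReal.coe_mul, ENNReal.coe_le_coe]
    calc ε * N ≤ δ / (N + 1) * N := by gcongr; exact min_le_right _ _
      _ ≤ δ / (N + 1) * (N + 1) := by gcongr; simp
      _ = δ := div_mul_cancel₀ _ (by positivity)

theorem sum_apply_add {n : ℕ} (T : Finset (Fin n)) (a b : Fin n →₀ ℕ) :
    ∑ i ∈ T, (a + b) i = ∑ i ∈ T, a i + ∑ i ∈ T, b i := by
  simp [sum_add_distrib]

/-- If `f = a (1 - v)` with `a` the constant term, then `a f⁻¹` solves the equation `q = 1 + v q`,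
which is contractive on small polydiscs because `v` has no constant term. -/
theorem inv_mem_convergentIn {n : ℕ} {s : Finset (Fin n)} {f : FormalRing n}
    (hf : f ∈ convergentIn s) (h0 : constantCoeff f ≠ 0) : f⁻¹ ∈ convergentIn s := by
  let v : FormalRing n := 1 - (constantCoeff f)⁻¹ • f
  have hvs : v ∈ convergentIn s :=
    Subalgebra.sub_mem _ (Subalgebra.one_mem _) (Subalgebra.smul_mem _ hf _)
  have hv0 : ∀ d : Fin n →₀ ℕ, ∑ i, d i < 1 → coeff d v = 0 := by
    intro d hd
    have : d = 0 := by
      ext i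
      have := single_le_sum (f := fun i => d i) (fun _ _ => Nat.zero_le _) (mem_univ i)
      simp only [Finsupp.coe_zero, Pi.zero_apply]
      omega
    subst this
    simp [v, h0]
  let L : FormalRing n →+ FormalRing n := AddMonoidHom.mulLeft v
  have hL : ∀ k q, (∀ d : Fin n →₀ ℕ, ∑ i, d i < k → coeff d q = 0) →
      ∀ d : Fin n →₀ ℕ, ∑ i, d i < k + 1 → coeff d (L q) = 0 := by
    intro k q hq d hd
    exact coeff_mul_eq_zero_of_weight (w := fun d => ∑ i, d i) (sum_apply_add univ) hv0 hq d
      (by omega)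
  obtain ⟨q, hq, hnorm, hsupp⟩ := exists_eq_add_of_raises_weight (fun d => ∑ i, d i) L hL 1
  obtain ⟨r, hr, hrv⟩ := (isConvergent_iff_polydiscNorm v).1 hvs.1
  obtain ⟨τ, hτ, -, -, hτv⟩ := exists_polydiscNorm_le univ hv0 (ρ := fun _ => r) (fun _ => hr) hrv
    (δ := 2⁻¹) (by positivity)
  have hqc : IsConvergent q := by
    refine isConvergent_of_polydiscNorm hτ (ne_top_of_le_ne_top ?_ (hnorm τ fun p => ?_))
    · rw [← monomial_zero_one, polydiscNorm_monomial]
      finiteness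
    · refine (polydiscNorm_mul_le τ v p).trans ?_
      gcongr
      simpa using hτv
  have hqs : q ∈ convergentIn s := by
    refine ⟨hqc, hsupp (fun d => d.support ⊆ s) ?_ ?_⟩
    · exact (Subalgebra.one_mem (supportedIn s) :)
    · intro p hp
      exact (Subalgebra.mul_mem (supportedIn s) hvs.2 hp :)
  have hfq : (constantCoeff f)⁻¹ • q * f = 1 := by
    have h1 : q = 1 + v * q := hq
    have h2 : q * ((constantCoeff f)⁻¹ • f) = 1 := by
      have : (constantCoeff f)⁻¹ • f = 1 - v := by simp [v]
      rw [this, mul_sub, mul_one, mul_comm q v]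
      nth_rewrite 1 [h1]
      ring
    rw [smul_mul_assoc, ← mul_smul_comm, h2]
  rw [(MvPowerSeries.inv_eq_iff_mul_eq_one h0).2 hfq]
  exact Subalgebra.smul_mem _ hqs _

theorem isUnit_convergentIn {n : ℕ} {s : Finset (Fin n)} (f : convergentIn s)
    (h0 : constantCoeff (f : FormalRing n) ≠ 0) : IsUnit f :=
  IsUnit.of_mul_eq_one ⟨_, inv_mem_convergentIn f.2 h0⟩
    (Subtype.ext (MvPowerSeries.mul_inv_cancel _ h0))

theorem constantCoeff_ne_zero_of_isUnit {n : ℕ} {S : Subalgebra ℂ (FormalRing n)} {f : S}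
    (hf : IsUnit f) : constantCoeff (f : FormalRing n) ≠ 0 :=
  (MvPowerSeries.isUnit_iff_constantCoeff.1 (hf.map S.val)).ne_zero

/-! ### Weierstrass division -/

/-- The quotient of the division by `xₜ ^ d`, the remainder consisting of the terms of degree less
than `d` in `xₜ`. -/
noncomputable def divXPow {n : ℕ} (t : Fin n) (d : ℕ) : FormalRing n →ₗ[ℂ] FormalRing n where
  toFun f := fun e => coeff (e + Finsupp.single t d) f
  map_add' f g := by ext e; rfl
  map_smul' a f := by ext e; rfl

theorem coeff_divXPow {n : ℕ} (t : Fin n) (d : ℕ) (f : FormalRing n) (e : Fin n →₀ ℕ) :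
    coeff e (divXPow t d f) = coeff (e + Finsupp.single t d) f := rfl

theorem polydiscNorm_divXPow_le {n : ℕ} (ρ : Fin n → ℝ≥0) (t : Fin n) (d : ℕ) (f : FormalRing n) :
    polydiscNorm ρ (divXPow t d f) * ρ t ^ d ≤ polydiscNorm ρ f := by
  rw [polydiscNorm, ← ENNReal.tsum_mul_right, polydiscNorm]
  refine le_trans (le_of_eq ?_) (ENNReal.tsum_comp_le_tsum_of_injective
    (add_left_injective (Finsupp.single t d)) fun e => ‖coeff e f‖ₑ * radiusMonomial ρ e)
  refine tsum_congr fun e => ?_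
  simp only [coeff_divXPow, radiusMonomial_add, radiusMonomial_single]
  push_cast
  ring

theorem coeff_mul_X_pow {n : ℕ} (t : Fin n) (d : ℕ) (f : FormalRing n) (e : Fin n →₀ ℕ) :
    coeff e (f * X t ^ d) = if d ≤ e t then coeff (e - Finsupp.single t d) f else 0 := by
  classical
  rw [X_pow_eq, coeff_mul_monomial]
  simp [Finsupp.single_le_iff]

theorem divXPow_mul_X_pow {n : ℕ} (t : Fin n) (d : ℕ) (f : FormalRing n) :
    divXPow t d (f * X t ^ d) = f := by
  ext e
  rw [coeff_divXPow, coeff_mul_X_pow, if_pos (by simp), add_tsub_cancel_right]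

theorem coeff_sub_divXPow_mul {n : ℕ} (t : Fin n) (d : ℕ) (f : FormalRing n) (e : Fin n →₀ ℕ) :
    coeff e (f - divXPow t d f * X t ^ d) = if e t < d then coeff e f else 0 := by
  rw [map_sub, coeff_mul_X_pow]
  by_cases h : d ≤ e t
  · rw [if_pos h, coeff_divXPow, tsub_add_cancel_of_le (Finsupp.single_le_iff.2 h), sub_self,
      if_neg (by omega)]
  · rw [if_neg h, if_pos (by omega), sub_zero]

theorem divXPow_eq_zero {n : ℕ} {t : Fin n} {d : ℕ} {f : FormalRing n}
    (hf : ∀ e, d ≤ e t → coeff e f = 0) : divXPow t d f = 0 := by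
  ext e
  rw [coeff_divXPow, hf _ (by simp)]
  simp

theorem divXPow_mem_convergentIn {n : ℕ} {s : Finset (Fin n)} (t : Fin n) (d : ℕ)
    {f : FormalRing n} (hf : f ∈ convergentIn s) : divXPow t d f ∈ convergentIn s := by
  classical
  refine ⟨?_, fun e he => ?_⟩
  · obtain ⟨r, hr, h⟩ := (isConvergent_iff_polydiscNorm f).1 hf.1
    refine isConvergent_of_polydiscNorm (fun _ => hr) fun h' => h ?_
    have := polydiscNorm_divXPow_le (fun _ => r) t d f
    rwa [h', ENNReal.top_mul (by exact_mod_cast (pow_pos hr d).ne'), top_le_iff] at this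
  · rw [coeff_divXPow, hf.2]
    refine fun h => he (subset_trans ?_ h)
    intro i hi
    simp only [Finsupp.mem_support_iff, Finsupp.coe_add, Pi.add_apply] at hi ⊢
    omega

/-- Weierstrass division by `xₜ ^ d + v`, where `v` vanishes on the `xₜ`-axis. If `D` denotes the
quotient of the division by `xₜ ^ d`, the quotient `q` solves `q = D h - D (v q)`. This operator
raises the degree in the variables other than `xₜ`, and it is contractive if their radii are small
compared with that of `xₜ`. -/
theorem exists_weierstrass_division {n : ℕ} {s : Finset (Fin n)} {t : Fin n} (ht : t ∈ s) (d : ℕ)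
    {v : FormalRing n} (hv : v ∈ convergentIn s)
    (hv0 : ∀ e, ∑ i ∈ univ.erase t, e i < 1 → coeff e v = 0)
    {h : FormalRing n} (hh : h ∈ convergentIn s) :
    ∃ q ∈ convergentIn s, ∃ r ∈ convergentIn s, (∀ e, d ≤ e t → coeff e r = 0) ∧
      h = q * (X t ^ d + v) + r := by
  classical
  let L : FormalRing n →+ FormalRing n :=
    (-(divXPow t d) : FormalRing n →ₗ[ℂ] FormalRing n).toAddMonoidHom.comp (AddMonoidHom.mulLeft v)
  have hLdef : ∀ q, L q = - divXPow t d (v * q) := fun q => rfl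
  have hw : ∀ e : Fin n →₀ ℕ, ∑ i ∈ univ.erase t, (e + Finsupp.single t d) i =
      ∑ i ∈ univ.erase t, e i := by
    intro e
    refine sum_congr rfl fun i hi => ?_
    simp [Finsupp.single_eq_of_ne (ne_of_mem_erase hi)]
  have hL : ∀ k q, (∀ e : Fin n →₀ ℕ, ∑ i ∈ univ.erase t, e i < k → coeff e q = 0) →
      ∀ e : Fin n →₀ ℕ, ∑ i ∈ univ.erase t, e i < k + 1 → coeff e (L q) = 0 := by
    intro k q hq e he
    rw [hLdef, map_neg, coeff_divXPow, neg_eq_zero]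
    refine coeff_mul_eq_zero_of_weight (w := fun e => ∑ i ∈ univ.erase t, e i) (sum_apply_add _)
      hv0 hq _ ?_
    simp only [hw]
    omega
  obtain ⟨q, hq, hnorm, hsupp⟩ := exists_eq_add_of_raises_weight
    (fun e => ∑ i ∈ univ.erase t, e i) L hL (divXPow t d h)
  have hh' := divXPow_mem_convergentIn t d hh
  obtain ⟨r₁, hr₁, hr₁v⟩ := (isConvergent_iff_polydiscNorm v).1 hv.1
  obtain ⟨r₂, hr₂, hr₂h⟩ := (isConvergent_iff_polydiscNorm _).1 hh'.1
  let r := min r₁ r₂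
  have hr : 0 < r := lt_min hr₁ hr₂
  obtain ⟨τ, hτ, hτr, hτt, hτv⟩ := exists_polydiscNorm_le (univ.erase t) hv0 (ρ := fun _ => r)
    (fun _ => hr)
    (ne_top_of_le_ne_top hr₁v (polydiscNorm_mono (fun _ => min_le_left _ _) v))
    (δ := 2⁻¹ * r ^ d) (by positivity)
  have hτt' : τ t = r := hτt t (by simp)
  have hqc : IsConvergent q := by
    refine isConvergent_of_polydiscNorm hτ (ne_top_of_le_ne_top ?_ (hnorm τ fun p => ?_))
    · refine ENNReal.mul_ne_top (by simp) (ne_top_of_le_ne_top hr₂h (polydiscNorm_mono ?_ _))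
      exact hτr.trans fun _ => min_le_right _ _
    · have hrd0 : (r : ℝ≥0∞) ^ d ≠ 0 := by exact_mod_cast (pow_pos hr d).ne'
      have hrdt : (r : ℝ≥0∞) ^ d ≠ ⊤ := by finiteness
      have h1 := polydiscNorm_divXPow_le τ t d (v * p)
      rw [hτt'] at h1
      rw [hLdef, polydiscNorm_neg, ← ENNReal.mul_le_mul_iff_left hrd0 hrdt]
      refine h1.trans ((polydiscNorm_mul_le τ v p).trans ?_)
      calc _ ≤ ((2⁻¹ * r ^ d : ℝ≥0) : ℝ≥0∞) * polydiscNorm τ p := by gcongr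
        _ = _ := by
          push_cast
          ring
  have hqs : q ∈ convergentIn s := by
    refine ⟨hqc, hsupp (fun e => e.support ⊆ s) hh'.2 fun p hp e he => ?_⟩
    have hvp : v * p ∈ supportedIn s := Subalgebra.mul_mem _ hv.2 hp
    rw [hLdef, map_neg, coeff_divXPow, hvp, neg_zero]
    refine fun h' => he (subset_trans ?_ h')
    intro i hi
    simp only [Finsupp.mem_support_iff, Finsupp.coe_add, Pi.add_apply] at hi ⊢
    omega
  have hXs : X t ^ d ∈ convergentIn s := Subalgebra.pow_mem _ (X_mem_convergentIn ht) d
  refine ⟨q, hqs, h - q * (X t ^ d + v), Subalgebra.sub_mem _ hh (Subalgebra.mul_mem _ hqs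
    (Subalgebra.add_mem _ hXs hv)), fun e he => ?_, by ring⟩
  have hq2 : q = divXPow t d (h - v * q) := by
    rw [map_sub, sub_eq_add_neg, ← hLdef]
    exact hq
  have : h - q * (X t ^ d + v) = (h - v * q) - divXPow t d (h - v * q) * X t ^ d := by
    rw [← hq2]
    ring
  rw [this, coeff_sub_divXPow_mul, if_neg (by omega)]

/-- Uniqueness of Weierstrass division by `xₜ ^ d + v`: a multiple of this series with degree
less than `d` in `xₜ` vanishes. -/
theorem eq_zero_of_mul_weierstrass {n : ℕ} {t : Fin n} {d : ℕ} {v q : FormalRing n}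
    (hv0 : ∀ e, ∑ i ∈ univ.erase t, e i < 1 → coeff e v = 0)
    (hq : ∀ e, d ≤ e t → coeff e (q * (X t ^ d + v)) = 0) : q = 0 := by
  classical
  refine eq_zero_of_raises_weight (fun e => ∑ i ∈ univ.erase t, e i)
    (fun q => - divXPow t d (v * q)) ?_ ?_
  · intro k q hq e he
    rw [map_neg, coeff_divXPow, neg_eq_zero]
    refine coeff_mul_eq_zero_of_weight (w := fun e => ∑ i ∈ univ.erase t, e i) (sum_apply_add _)
      hv0 hq _ ?_
    rw [sum_apply_add]
    have : ∑ i ∈ univ.erase t, (Finsupp.single t d) i = 0 :=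
      sum_eq_zero fun i hi => Finsupp.single_eq_of_ne (ne_of_mem_erase hi)
    omega
  · have := divXPow_eq_zero hq
    rw [mul_add, map_add, divXPow_mul_X_pow, mul_comm q v] at this
    exact eq_neg_of_add_eq_zero_left this

/-! ### Linear coordinate changes -/

/-- Substituting series of norm at most `r` maps a series that converges on the polydisc of radius
`r` to a convergent one. -/
theorem polydiscNorm_subst_le {n : ℕ} {a : Fin n → FormalRing n}
    (ha : HasSubst a) {ρ : Fin n → ℝ≥0} {r : ℝ≥0}
    (har : ∀ i, polydiscNorm ρ (a i) ≤ r) (f : FormalRing n) :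
    polydiscNorm ρ (subst a f) ≤ polydiscNorm (fun _ => r) f := by
  have h1 : ∀ e, ‖coeff e (subst a f)‖ₑ ≤
      ∑' d : Fin n →₀ ℕ, ‖coeff d f‖ₑ * ‖coeff e (∏ i, a i ^ d i)‖ₑ := by
    intro e
    rw [coeff_subst ha, finsum_eq_sum_of_support_subset _
      (s := (coeff_subst_finite ha f e).toFinset) (by simp)]
    refine (enorm_sum_le _ _).trans ?_
    refine le_trans (le_of_eq (sum_congr rfl fun d _ => ?_)) (ENNReal.sum_le_tsum _)
    rw [smul_eq_mul, enorm_mul, Finsupp.prod_fintype _ _ (by simp)]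
  calc polydiscNorm ρ (subst a f)
      ≤ ∑' e, (∑' d : Fin n →₀ ℕ, ‖coeff d f‖ₑ * ‖coeff e (∏ i, a i ^ d i)‖ₑ) *
          radiusMonomial ρ e := ENNReal.tsum_le_tsum fun e => by gcongr; exact h1 e
    _ = ∑' d : Fin n →₀ ℕ, ‖coeff d f‖ₑ * polydiscNorm ρ (∏ i, a i ^ d i) := by
        simp_rw [← ENNReal.tsum_mul_right]
        rw [ENNReal.tsum_comm]
        refine tsum_congr fun d => ?_
        rw [polydiscNorm, ← ENNReal.tsum_mul_left]
        exact tsum_congr fun e => mul_assoc _ _ _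
    _ ≤ polydiscNorm (fun _ => r) f := by
        refine ENNReal.tsum_le_tsum fun d => ?_
        gcongr
        refine (polydiscNorm_prod_le _ _ _).trans ?_
        rw [radiusMonomial]
        push_cast
        exact prod_le_prod' fun i _ => (polydiscNorm_pow_le _ _ _).trans (by gcongr; exact har i)

/-- The linear substitution `xᵢ ↦ xᵢ + cᵢ xₜ`. -/
noncomputable def shear {n : ℕ} (t : Fin n) (c : Fin n → ℂ) (i : Fin n) : FormalRing n :=
  X i + c i • X t

theorem hasSubst_shear {n : ℕ} (t : Fin n) (c : Fin n → ℂ) : HasSubst (shear t c) :=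
  hasSubst_of_constantCoeff_zero fun i => by
    simp [shear]

theorem subst_shear_shear {n : ℕ} (t : Fin n) {c c' : Fin n → ℂ}
    (h : ∀ i, c i + c' i + c i * c' t = 0) (f : FormalRing n) :
    subst (shear t c') (subst (shear t c) f) = f := by
  rw [subst_comp_subst_apply (hasSubst_shear t c) (hasSubst_shear t c')]
  have : (fun i => subst (shear t c') (shear t c i)) = (X : Fin n → FormalRing n) := by
    funext i
    have hX : ∀ j, substAlgHom (hasSubst_shear t c') (X j : FormalRing n) = shear t c' j :=
      fun j => substAlgHom_X _ j
    rw [← coe_substAlgHom (hasSubst_shear t c'), shear, map_add, map_smul, hX, hX, shear, shear,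
      smul_add, smul_smul, add_assoc, ← add_assoc (c' i • _), add_comm (c' i • _), add_assoc,
      ← add_smul, ← add_smul]
    have : c i + (c' i + c i * c' t) = 0 := by rw [← h i]; ring
    rw [this, zero_smul, add_zero]
  rw [this, subst_self, id]

theorem subst_shear_mem_convergentIn {n : ℕ} {s : Finset (Fin n)} {t : Fin n} (ht : t ∈ s)
    (c : Fin n → ℂ) {f : FormalRing n} (hf : f ∈ convergentIn s) :
    subst (shear t c) f ∈ convergentIn s := by
  refine ⟨?_, fun e he => ?_⟩
  · obtain ⟨r, hr, hfr⟩ := (isConvergent_iff_polydiscNorm f).1 hf.1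
    let K : ℝ≥0 := 1 + ∑ i, ‖c i‖₊
    have hK : 0 < K := by positivity
    refine isConvergent_of_polydiscNorm (ρ := fun _ => r / K) (fun _ => div_pos hr hK)
      (ne_top_of_le_ne_top hfr (polydiscNorm_subst_le (hasSubst_shear t c) (fun i => ?_) f))
    have hX : ∀ (b : ℂ) (j : Fin n), polydiscNorm (fun _ => r / K) (b • X j : FormalRing n) =
        ‖b‖ₑ * (r / K : ℝ≥0) := by
      intro b j
      rw [X, ← map_smul, polydiscNorm_monomial, radiusMonomial_single]
      simp
    have hX1 := hX 1 i
    rw [one_smul] at hX1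
    refine (polydiscNorm_add_le _ _ _).trans ?_
    rw [hX, hX1, ← add_mul, enorm_one, enorm_eq_nnnorm, ← ENNReal.coe_one, ← ENNReal.coe_add,
      ← ENNReal.coe_mul, ENNReal.coe_le_coe]
    calc (1 + ‖c i‖₊) * (r / K) ≤ K * (r / K) := by
          gcongr
          change 1 + _ ≤ 1 + _
          gcongr
          exact single_le_sum (f := fun i => ‖c i‖₊) (fun _ _ => zero_le) (mem_univ i)
      _ = r := mul_div_cancel₀ _ hK.ne'
  · rw [coeff_subst (hasSubst_shear t c), finsum_eq_zero_of_forall_eq_zero]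
    intro d
    by_cases hd : d.support ⊆ s
    · have : (d.prod fun i k => shear t c i ^ k) ∈ supportedIn s := by
        refine Subalgebra.prod_mem _ fun i hi => Subalgebra.pow_mem _ ?_ _
        exact Subalgebra.add_mem _ (X_mem_convergentIn (hd hi)).2
          (Subalgebra.smul_mem _ (X_mem_convergentIn ht).2 _)
      rw [this e he, smul_zero]
    · rw [hf.2 d hd, zero_smul]

/-- The restriction of a power series to the `xₜ`-axis. -/
noncomputable def axisRestriction {n : ℕ} (t : Fin n) : FormalRing n →+* PowerSeries ℂ where
  toFun f := PowerSeries.mk fun k => coeff (Finsupp.single t k) f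
  map_one' := by
    classical
    ext k
    simp [coeff_one, PowerSeries.coeff_one]
  map_mul' f g := by
    classical
    ext k
    rw [PowerSeries.coeff_mk, PowerSeries.coeff_mul, coeff_mul, Finsupp.antidiagonal_single,
      sum_map]
    simp
  map_zero' := by ext k; simp
  map_add' f g := by ext k; simp

theorem coeff_axisRestriction {n : ℕ} (t : Fin n) (f : FormalRing n) (k : ℕ) :
    PowerSeries.coeff k (axisRestriction t f) = coeff (Finsupp.single t k) f :=
  PowerSeries.coeff_mk k fun k => coeff (Finsupp.single t k) f

theorem axisRestriction_shear {n : ℕ} (t : Fin n) (c : Fin n → ℂ) (i : Fin n) :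
    axisRestriction t (shear t c i) =
      PowerSeries.C (c i + if i = t then 1 else 0) * PowerSeries.X := by
  classical
  ext k
  rw [coeff_axisRestriction, PowerSeries.coeff_C_mul, PowerSeries.coeff_X, shear, map_add,
    map_smul, coeff_X, coeff_X]
  by_cases hk : k = 1
  · subst hk
    by_cases hi : i = t
    · subst hi
      simp [add_comm]
    · have : Finsupp.single t 1 ≠ Finsupp.single i 1 := fun h =>
        hi (Finsupp.single_left_injective one_ne_zero h).symm
      simp [hi, this]
  · have h1 : ∀ j, Finsupp.single t k ≠ Finsupp.single j 1 := by
      intro j h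
      have := congrArg Finsupp.degree h
      simp at this
      exact hk this
    simp [h1, hk]

/-- After a suitable linear coordinate change preserving `xₜ = 0`, a nonzero power series does
not vanish on the `xₜ`-axis. -/
theorem exists_shear_regular {n : ℕ} (t : Fin n) {f : FormalRing n} (hf : f ≠ 0) :
    ∃ c : Fin n → ℂ, 1 + c t ≠ 0 ∧ ∃ m, coeff (Finsupp.single t m) (subst (shear t c) f) ≠ 0 := by
  classical
  obtain ⟨d₀, hd₀, hdm⟩ := exists_coeff_ne_zero_and_order (ne_zero_iff_order_finite.mp hf)
  set m := d₀.degree with hm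
  have hlow : ∀ d : Fin n →₀ ℕ, d.degree < m → coeff d f = 0 := fun d hd =>
    coeff_of_lt_order (by rw [← hdm]; exact_mod_cast hd)
  -- `F` is the initial form of `f`.
  let F : MvPolynomial (Fin n) ℂ := truncTotal (m + 1) f
  have hFc : ∀ d : Fin n →₀ ℕ, MvPolynomial.coeff d F = if d.degree < m + 1 then coeff d f else 0 :=
    fun d => coeff_truncTotal_eq_ite ..
  have hF : F ≠ 0 := by
    intro h
    have := hFc d₀
    rw [h, if_pos (by omega)] at this
    exact hd₀ this.symm
  obtain ⟨p, hp⟩ : ∃ p : Fin n → ℂ, MvPolynomial.eval p (F * MvPolynomial.X t) ≠ 0 := by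
    by_contra! h
    exact mul_ne_zero hF (MvPolynomial.X_ne_zero t) (MvPolynomial.funext fun x => by simp [h x])
  rw [map_mul, MvPolynomial.eval_X] at hp
  refine ⟨fun i => p i - if i = t then 1 else 0, by simpa using right_ne_zero_of_mul hp, m, ?_⟩
  have key : ∀ d : Fin n →₀ ℕ, coeff (Finsupp.single t m)
      (d.prod fun i k => shear t (fun i => p i - if i = t then 1 else 0) i ^ k) =
        if d.degree = m then ∏ i, p i ^ d i else 0 := by
    intro d
    rw [← coeff_axisRestriction, Finsupp.prod_fintype _ _ (by simp), map_prod]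
    simp_rw [map_pow, axisRestriction_shear, sub_add_cancel, mul_pow]
    rw [prod_mul_distrib, prod_pow_eq_pow_sum, ← Finsupp.degree_eq_sum]
    simp_rw [← map_pow]
    rw [← map_prod, PowerSeries.coeff_C_mul, PowerSeries.coeff_X_pow]
    simp [eq_comm]
  rw [coeff_subst (hasSubst_shear t _)]
  simp_rw [key]
  rw [finsum_eq_sum_of_support_subset (s := F.support)]
  · have : MvPolynomial.eval p F = ∑ d ∈ F.support, coeff d f •
        (if d.degree = m then ∏ i, p i ^ d i else 0) := by
      rw [MvPolynomial.eval_eq']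
      refine sum_congr rfl fun d hd => ?_
      have h1 := hFc d
      have h2 := MvPolynomial.mem_support_iff.mp hd
      have h3 : d.degree = m := by
        by_contra hne
        rcases lt_or_gt_of_ne hne with h | h
        · exact h2 (by rw [h1, hlow d h, ite_self])
        · exact h2 (by rw [h1, if_neg (by omega)])
      rw [h1, if_pos (by omega), if_pos h3, smul_eq_mul]
    rw [← this]
    exact left_ne_zero_of_mul hp
  · intro d hd
    have hd' := Function.mem_support.mp hd
    have h3 : d.degree = m := by
      by_contra hne
      exact hd' (by rw [if_neg hne, smul_zero])
    rw [mem_coe, MvPolynomial.mem_support_iff, hFc, if_pos (by omega)]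
    exact left_ne_zero_of_smul hd'

/-- Some automorphism of `ℂ{xᵢ : i ∈ s}` makes a given nonzero series nonzero on the `xₜ`-axis. -/
theorem exists_ringEquiv_regular {n : ℕ} {s : Finset (Fin n)} {t : Fin n} (ht : t ∈ s)
    {f : convergentIn s} (hf : f ≠ 0) :
    ∃ σ : convergentIn s ≃+* convergentIn s,
      ∃ m, coeff (Finsupp.single t m) (σ f : FormalRing n) ≠ 0 := by
  obtain ⟨c, hc, m, hm⟩ := exists_shear_regular t (f := (f : FormalRing n))
    (fun h => hf (Subtype.ext h))
  -- The parameters of the inverse coordinate change.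
  let c' : Fin n → ℂ := fun i => - c i / (1 + c t)
  let φ (c : Fin n → ℂ) : convergentIn s →+* convergentIn s :=
    ((substAlgHom (hasSubst_shear t c)).toRingHom.comp (convergentIn s).val.toRingHom).codRestrict
      (convergentIn s).toSubring fun g => by
        change substAlgHom (hasSubst_shear t c) (g : FormalRing n) ∈ _
        rw [coe_substAlgHom]
        exact subst_shear_mem_convergentIn ht c g.2
  have hφ : ∀ c g, (φ c g : FormalRing n) = subst (shear t c) (g : FormalRing n) := by
    intro c g
    change substAlgHom (hasSubst_shear t c) (g : FormalRing n) = _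
    rw [coe_substAlgHom]
  refine ⟨RingEquiv.ofRingHom (φ c) (φ c') ?_ ?_, m, ?_⟩
  · ext1 g
    refine Subtype.ext ?_
    simp only [RingHom.comp_apply, hφ, RingHom.id_apply]
    exact subst_shear_shear t (fun i => by simp only [c']; field_simp; ring) _
  · ext1 g
    refine Subtype.ext ?_
    simp only [RingHom.comp_apply, hφ, RingHom.id_apply]
    exact subst_shear_shear t (fun i => by simp only [c']; field_simp; ring) _
  · rw [RingEquiv.ofRingHom_apply, hφ]
    exact hm

/-! ### Convergent power series form a Noetherian factorial ring -/

/-- The inclusion of `ℂ{xᵢ : i ∈ s, i ≠ t}[xₜ]` in `ℂ{xᵢ : i ∈ s}`. -/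
noncomputable def polynomialMap {n : ℕ} {s : Finset (Fin n)} {t : Fin n} (ht : t ∈ s) :
    Polynomial (convergentIn (s.erase t)) →+* convergentIn s :=
  Polynomial.eval₂RingHom (Subalgebra.inclusion (convergentIn_mono (erase_subset t s))).toRingHom
    ⟨X t, X_mem_convergentIn ht⟩

theorem coe_polynomialMap_monomial {n : ℕ} {s : Finset (Fin n)} {t : Fin n} (ht : t ∈ s) (k : ℕ)
    (a : convergentIn (s.erase t)) :
    ((polynomialMap ht (Polynomial.monomial k a) : convergentIn s) : FormalRing n) =
      (a : FormalRing n) * X t ^ k := by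
  rw [polynomialMap, Polynomial.coe_eval₂RingHom, Polynomial.eval₂_monomial]
  rfl

theorem coeff_polynomialMap {n : ℕ} {s : Finset (Fin n)} {t : Fin n} (ht : t ∈ s)
    (P : Polynomial (convergentIn (s.erase t))) (e : Fin n →₀ ℕ) :
    coeff e ((polynomialMap ht P : convergentIn s) : FormalRing n) =
      coeff (e.erase t) (P.coeff (e t) : FormalRing n) := by
  induction P using Polynomial.induction_on' with
  | add P Q hP hQ =>
    rw [map_add, Subalgebra.coe_add, map_add, hP, hQ, Polynomial.coeff_add, Subalgebra.coe_add,
      map_add]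
  | monomial k a =>
    rw [coe_polynomialMap_monomial, coeff_mul_X_pow, Polynomial.coeff_monomial]
    rcases lt_trichotomy k (e t) with h | h | h
    · rw [if_pos h.le, if_neg h.ne, a.2.2]
      · simp
      · intro hsub
        have : t ∈ (e - Finsupp.single t k).support := by
          simp only [Finsupp.mem_support_iff, Finsupp.coe_tsub, Pi.sub_apply,
            Finsupp.single_eq_same]
          omega
        exact notMem_erase t s (hsub this)
    · rw [if_pos h.le, if_pos h]
      congr 2
      ext i
      by_cases hi : i = t
      · subst hi
        simp [h]
      · simp [hi]
    · rw [if_neg (by omega), if_neg h.ne']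
      simp

theorem polynomialMap_injective {n : ℕ} {s : Finset (Fin n)} {t : Fin n} (ht : t ∈ s) :
    Function.Injective (polynomialMap ht) := by
  rw [injective_iff_map_eq_zero]
  intro P hP
  ext k e
  by_cases he : e.support ⊆ s.erase t
  · have het : e t = 0 := by
      by_contra h
      exact notMem_erase t s (he (Finsupp.mem_support_iff.2 h))
    have := coeff_polynomialMap ht P (e + Finsupp.single t k)
    rw [hP] at this
    have h1 : (e + Finsupp.single t k).erase t = e := by
      ext i
      by_cases hi : i = t
      · subst hi
        simp [het]
      · simp [hi]
    rw [h1] at this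
    simpa [het] using this.symm
  · rw [(P.coeff k).2.2 e he]
    simp

/-- A series of degree less than `d` in `xₜ` is a polynomial in `xₜ`. -/
theorem exists_polynomialMap_eq {n : ℕ} {s : Finset (Fin n)} {t : Fin n} (ht : t ∈ s) {d : ℕ}
    (r : convergentIn s) (hr : ∀ e, d ≤ e t → coeff e (r : FormalRing n) = 0) :
    ∃ P : Polynomial (convergentIn (s.erase t)), P.degree < d ∧ polynomialMap ht P = r := by
  classical
  have hc : ∀ j e, coeff e (divXPow t j (r : FormalRing n) -
      divXPow t 1 (divXPow t j (r : FormalRing n)) * X t ^ 1) =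
        if e t < 1 then coeff (e + Finsupp.single t j) (r : FormalRing n) else 0 := fun j e =>
    coeff_sub_divXPow_mul t 1 _ e
  let c : ℕ → convergentIn (s.erase t) := fun j =>
    ⟨divXPow t j (r : FormalRing n) - divXPow t 1 (divXPow t j (r : FormalRing n)) * X t ^ 1, by
      have h1 := divXPow_mem_convergentIn t j r.2
      have h2 := Subalgebra.sub_mem _ h1 (Subalgebra.mul_mem _ (divXPow_mem_convergentIn t 1 h1)
        (Subalgebra.pow_mem _ (X_mem_convergentIn ht) 1))
      refine ⟨h2.1, fun e he => ?_⟩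
      by_cases hes : e.support ⊆ s
      · rw [hc, if_neg]
        intro h
        refine he fun i hi => mem_erase.2 ⟨?_, hes hi⟩
        rintro rfl
        have := Finsupp.mem_support_iff.1 hi
        omega
      · exact h2.2 e hes⟩
  have hP : ∀ k, (∑ j ∈ range d, Polynomial.monomial j (c j)).coeff k = if k < d then c k else 0 := by
    intro k
    simp [Polynomial.finsetSum_coeff, Polynomial.coeff_monomial]
  refine ⟨∑ j ∈ range d, Polynomial.monomial j (c j), ?_, ?_⟩
  · rw [Polynomial.degree_lt_iff_coeff_zero]
    intro k hk
    rw [hP, if_neg (by omega)]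
  · refine Subtype.ext (MvPowerSeries.ext fun e => ?_)
    rw [coeff_polynomialMap, hP]
    by_cases h : e t < d
    · rw [if_pos h]
      refine (hc _ _).trans ?_
      rw [if_pos (by simp), Finsupp.erase_add_single]
    · rw [if_neg h, hr e (by omega)]
      simp

/-- The Weierstrass preparation of a series that does not vanish on the `xₜ`-axis, up to the
removal of a unit. -/
theorem exists_associated_weierstrass {n : ℕ} {s : Finset (Fin n)} {t : Fin n} (ht : t ∈ s)
    {g : convergentIn s} (hg : ∃ m, coeff (Finsupp.single t m) (g : FormalRing n) ≠ 0) :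
    ∃ (d : ℕ) (v : convergentIn s),
      (∀ e, ∑ i ∈ univ.erase t, e i < 1 → coeff e (v : FormalRing n) = 0) ∧
      Associated (⟨X t, X_mem_convergentIn ht⟩ ^ d + v) g := by
  classical
  let d := Nat.find hg
  have hd : coeff (Finsupp.single t d) (g : FormalRing n) ≠ 0 := Nat.find_spec hg
  have hlow : ∀ m < d, coeff (Finsupp.single t m) (g : FormalRing n) = 0 := fun m hm =>
    not_not.1 (Nat.find_min hg hm)
  let u : convergentIn s := ⟨divXPow t d (g : FormalRing n), divXPow_mem_convergentIn t d g.2⟩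
  have hu : IsUnit u := by
    refine isUnit_convergentIn u ?_
    rw [← coeff_zero_eq_constantCoeff_apply, coeff_divXPow, zero_add]
    exact hd
  obtain ⟨u, hu'⟩ := hu
  let x : convergentIn s := ⟨X t, X_mem_convergentIn ht⟩
  let w : convergentIn s := g - u * x ^ d
  have hw : (w : FormalRing n) = (g : FormalRing n) - divXPow t d (g : FormalRing n) * X t ^ d := by
    simp only [w, hu', Subalgebra.coe_sub, Subalgebra.coe_mul, Subalgebra.coe_pow, x]
    rfl
  refine ⟨d, ↑u⁻¹ * w, fun e he => ?_, u, ?_⟩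
  · rw [Subalgebra.coe_mul]
    refine coeff_mul_eq_zero_of_weight (w := fun e => ∑ i ∈ univ.erase t, e i) (k := 0) (l := 1)
      (sum_apply_add _) (fun _ h => absurd h (by simp)) (fun e he => ?_) e (by simpa using he)
    rw [hw, coeff_sub_divXPow_mul]
    have : e = Finsupp.single t (e t) := by
      ext i
      by_cases hi : i = t
      · subst hi
        simp
      · rw [Finsupp.single_eq_of_ne hi]
        have := single_le_sum (f := fun i => e i) (fun _ _ => Nat.zero_le _)
          (mem_erase.2 ⟨hi, mem_univ i⟩)
        have := Nat.lt_one_iff.1 (lt_of_le_of_lt this he)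
        exact this
    split_ifs with h
    · rw [this]
      exact hlow _ h
    · rfl
  · change (x ^ d + ↑u⁻¹ * w) * ↑u = g
    have : (↑u⁻¹ : convergentIn s) * u = 1 := u.inv_mul
    linear_combination (w) * this

theorem exists_dvd_sub_polynomialMap {n : ℕ} {s : Finset (Fin n)} {t : Fin n} (ht : t ∈ s) {d : ℕ}
    {v : convergentIn s}
    (hv : ∀ e, ∑ i ∈ univ.erase t, e i < 1 → coeff e (v : FormalRing n) = 0) (h : convergentIn s) :
    ∃ P : Polynomial (convergentIn (s.erase t)), P.degree < d ∧
      (⟨X t, X_mem_convergentIn ht⟩ ^ d + v) ∣ h - polynomialMap ht P := by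
  obtain ⟨q, hq, r, hr, hrd, hqr⟩ := exists_weierstrass_division ht d v.2 hv h.2
  obtain ⟨P, hPd, hP⟩ := exists_polynomialMap_eq ht ⟨r, hr⟩ hrd
  refine ⟨P, hPd, ⟨q, hq⟩, Subtype.ext ?_⟩
  rw [hP, Subalgebra.coe_sub, hqr, Subalgebra.coe_mul, Subalgebra.coe_add, Subalgebra.coe_pow]
  ring

theorem polynomialMap_eq_zero_of_dvd {n : ℕ} {s : Finset (Fin n)} {t : Fin n} (ht : t ∈ s) {d : ℕ}
    {v : convergentIn s}
    (hv : ∀ e, ∑ i ∈ univ.erase t, e i < 1 → coeff e (v : FormalRing n) = 0)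
    {P : Polynomial (convergentIn (s.erase t))} (hP : P.degree < d)
    (h : (⟨X t, X_mem_convergentIn ht⟩ ^ d + v) ∣ polynomialMap ht P) : P = 0 := by
  obtain ⟨q, hq⟩ := h
  have hq' : ((polynomialMap ht P : convergentIn s) : FormalRing n) =
      (q : FormalRing n) * (X t ^ d + (v : FormalRing n)) := by
    rw [hq, Subalgebra.coe_mul, Subalgebra.coe_add, Subalgebra.coe_pow, mul_comm]
  refine polynomialMap_injective ht ?_
  have h0 : (q : FormalRing n) = 0 := by
    refine eq_zero_of_mul_weierstrass hv (t := t) (d := d) fun e he => ?_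
    rw [← hq', coeff_polynomialMap, Polynomial.coeff_eq_zero_of_degree_lt
      (hP.trans_le (by exact_mod_cast he))]
    simp
  rw [map_zero]
  refine Subtype.ext ?_
  rw [hq', h0, zero_mul]
  rfl

/-- An irreducible series that does not vanish on the `xₜ`-axis is prime, if the ring of
convergent series in the other variables is factorial: it is associated with a monic polynomial
in `xₜ` that is irreducible, hence prime by the lemma of Gauss. -/
theorem prime_of_irreducible_of_regular {n : ℕ} {s : Finset (Fin n)} {t : Fin n} (ht : t ∈ s)
    [UniqueFactorizationMonoid (convergentIn (s.erase t))] {g : convergentIn s}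
    (hirr : Irreducible g) (hg : ∃ m, coeff (Finsupp.single t m) (g : FormalRing n) ≠ 0) :
    Prime g := by
  classical
  obtain ⟨d, v, hv, hass⟩ := exists_associated_weierstrass ht hg
  set g' : convergentIn s := ⟨X t, X_mem_convergentIn ht⟩ ^ d + v with hg'
  rw [← hass.prime_iff]
  replace hirr := hass.irreducible_iff.2 hirr
  -- The Weierstrass polynomial `W = xₜ ^ d - R`.
  obtain ⟨R, hRd, q, hq⟩ := exists_dvd_sub_polynomialMap (d := d) ht hv
    (⟨X t, X_mem_convergentIn ht⟩ ^ d)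
  rw [← hg'] at hq
  let W : Polynomial (convergentIn (s.erase t)) := Polynomial.X ^ d - R
  have hWm : W.Monic := Polynomial.monic_X_pow_sub hRd
  have hWdeg : W.degree = d := by
    rw [Polynomial.degree_sub_eq_left_of_degree_lt (by rwa [Polynomial.degree_X_pow]),
      Polynomial.degree_X_pow]
  have hWmap : polynomialMap ht W = g' * q := by
    rw [← hq, map_sub (polynomialMap ht), map_pow, polynomialMap, Polynomial.coe_eval₂RingHom,
      Polynomial.eval₂_X]
  have hq' : (X t : FormalRing n) ^ d - ((polynomialMap ht R : convergentIn s) : FormalRing n) =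
      (q : FormalRing n) * X t ^ d + (q : FormalRing n) * (v : FormalRing n) := by
    have := congrArg Subtype.val hq
    rw [hg', Subalgebra.coe_sub, Subalgebra.coe_mul, Subalgebra.coe_add, Subalgebra.coe_pow] at this
    rw [this]
    ring
  -- Comparison of the coefficients on the `xₜ`-axis, where `v` vanishes.
  have haxis : ∀ m, (if m = d then (1 : ℂ) else 0) -
      coeff 0 ((R.coeff m : convergentIn (s.erase t)) : FormalRing n) =
        if d ≤ m then coeff (Finsupp.single t (m - d)) (q : FormalRing n) else 0 := by
    intro m
    have h1 := congrArg (coeff (Finsupp.single t m)) hq'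
    have h2 : coeff (Finsupp.single t m) ((q : FormalRing n) * (v : FormalRing n)) = 0 := by
      refine coeff_mul_eq_zero_of_weight (w := fun e => ∑ i ∈ univ.erase t, e i) (k := 0) (l := 1)
        (sum_apply_add _) (fun _ h => absurd h (by simp)) hv _ ?_
      simp only [zero_add, Nat.lt_one_iff]
      exact sum_eq_zero fun i hi => Finsupp.single_eq_of_ne (ne_of_mem_erase hi)
    rw [map_sub, map_add, h2, add_zero, coeff_mul_X_pow, coeff_polynomialMap, coeff_X_pow] at h1
    simpa [← Finsupp.single_tsub, (Finsupp.single_injective t).eq_iff] using h1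
  have hRlow : ∀ m, coeff 0 ((R.coeff m : convergentIn (s.erase t)) : FormalRing n) = 0 := by
    intro m
    by_cases hm : d ≤ m
    · rw [Polynomial.coeff_eq_zero_of_degree_lt (hRd.trans_le (by exact_mod_cast hm))]
      simp
    · have := haxis m
      rw [if_neg (by omega), if_neg hm, zero_sub, neg_eq_zero] at this
      exact this
  have hqu : IsUnit q := by
    refine isUnit_convergentIn q ?_
    have := haxis d
    rw [if_pos rfl, if_pos le_rfl, hRlow, tsub_self, Finsupp.single_zero, sub_zero] at this
    rw [← coeff_zero_eq_constantCoeff_apply, ← this]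
    exact one_ne_zero
  have hassW : Associated g' (polynomialMap ht W) := ⟨hqu.unit, hWmap.symm⟩
  let ev : convergentIn (s.erase t) →+* ℂ :=
    (constantCoeff (σ := Fin n) (R := ℂ)).comp (convergentIn (s.erase t)).val.toRingHom
  have hev : ∀ a, ev a = constantCoeff (a : FormalRing n) := fun a => rfl
  have hWev : W.map ev = Polynomial.X ^ d := by
    have : R.map ev = 0 := by
      ext m
      rw [Polynomial.coeff_map, hev, ← coeff_zero_eq_constantCoeff_apply, hRlow,
        Polynomial.coeff_zero]
    rw [Polynomial.map_sub, this, sub_zero, Polynomial.map_pow, Polynomial.map_X]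
  -- A monic factor of `W` is a power of `xₜ` modulo the maximal ideal, so it is a unit as a
  -- power series only if it has degree zero.
  have hfac : ∀ P : Polynomial (convergentIn (s.erase t)), P.Monic → P ∣ W →
      IsUnit (polynomialMap ht P) → P.natDegree = 0 := by
    intro P hP hPW hPu
    have h1 : P.map ev ∣ Polynomial.X ^ d := hWev ▸ Polynomial.map_dvd ev hPW
    obtain ⟨k, hk, hass⟩ := (dvd_prime_pow Polynomial.prime_X d).1 h1
    have h2 : P.map ev = Polynomial.X ^ k :=
      Polynomial.eq_of_monic_of_associated (hP.map ev) (Polynomial.monic_X_pow k) hass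
    have h3 : k = 0 := by
      by_contra hk0
      refine constantCoeff_ne_zero_of_isUnit hPu ?_
      rw [← coeff_zero_eq_constantCoeff_apply, coeff_polynomialMap]
      have := congrArg (fun p => Polynomial.coeff p 0) h2
      simp only [Polynomial.coeff_map, hev, Polynomial.coeff_X_pow] at this
      rw [if_neg (Ne.symm hk0)] at this
      simpa using this
    rw [← hP.natDegree_map ev, h2, h3, pow_zero, Polynomial.natDegree_one]
  have hWirr : Irreducible W := by
    rw [hWm.irreducible_iff_natDegree]
    replace hirr := hassW.irreducible_iff.1 hirr
    refine ⟨fun h => hirr.not_isUnit (by rw [h, map_one]; exact isUnit_one), ?_⟩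
    intro A B hA hB hAB
    rw [← hAB, map_mul] at hirr
    rcases hirr.isUnit_or_isUnit rfl with h | h
    · exact Or.inl (hfac A hA (hAB ▸ dvd_mul_right A B) h)
    · exact Or.inr (hfac B hB (hAB ▸ dvd_mul_left B A) h)
  -- Divisibility by `g'` is tested on remainders, which are polynomials in `xₜ`.
  have hWp : Prime W := hWirr.prime
  refine ⟨hirr.ne_zero, hirr.not_isUnit, fun a b hab => ?_⟩
  obtain ⟨A, -, hA⟩ := exists_dvd_sub_polynomialMap (d := d) ht hv a
  obtain ⟨B, -, hB⟩ := exists_dvd_sub_polynomialMap (d := d) ht hv b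
  have hWdvd : ∀ P, W ∣ P → g' ∣ polynomialMap ht P := fun P hP =>
    hassW.dvd.trans (map_dvd _ hP)
  have hABdvd : g' ∣ polynomialMap ht (A * B) := by
    have : polynomialMap ht (A * B) = a * b - ((a - polynomialMap ht A) * b +
        polynomialMap ht A * (b - polynomialMap ht B)) := by
      rw [map_mul]
      ring
    rw [this]
    exact dvd_sub hab (dvd_add (hA.mul_right _) (hB.mul_left _))
  have hWAB : W ∣ A * B := by
    rw [← Polynomial.modByMonic_eq_zero_iff_dvd hWm]
    refine polynomialMap_eq_zero_of_dvd (d := d) ht hv ?_ ?_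
    · exact (Polynomial.degree_modByMonic_lt _ hWm).trans_le hWdeg.le
    · rw [← hg', ← add_sub_cancel_right (A * B %ₘ W) (W * (A * B /ₘ W)),
        Polynomial.modByMonic_add_div, map_sub]
      exact dvd_sub hABdvd (hWdvd _ (dvd_mul_right _ _))
  rcases hWp.dvd_or_dvd hWAB with h | h
  · exact Or.inl ((dvd_iff_dvd_of_dvd_sub hA).2 (hWdvd _ h))
  · exact Or.inr ((dvd_iff_dvd_of_dvd_sub hB).2 (hWdvd _ h))

/-- The quotient by a nonzero element is, by Weierstrass division and after a coordinate change, a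
quotient of the polynomial ring in `xₜ` over the convergent series in the other variables. -/
theorem isNoetherianRing_quotient {n : ℕ} {s : Finset (Fin n)} {t : Fin n} (ht : t ∈ s)
    [IsNoetherianRing (convergentIn (s.erase t))] {g : convergentIn s} (hg : g ≠ 0) :
    IsNoetherianRing (convergentIn s ⧸ Ideal.span {g}) := by
  obtain ⟨σ, hσ⟩ := exists_ringEquiv_regular ht hg
  obtain ⟨d, v, hv, hass⟩ := exists_associated_weierstrass ht hσ
  refine isNoetherianRing_of_surjective _ _
    ((Ideal.Quotient.mk (Ideal.span {g})).comp
      (σ.symm.toRingHom.comp (polynomialMap ht))) fun y => ?_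
  obtain ⟨h, rfl⟩ := Ideal.Quotient.mk_surjective y
  obtain ⟨P, -, hP⟩ := exists_dvd_sub_polynomialMap (d := d) ht hv (σ h)
  refine ⟨P, ?_⟩
  rw [RingHom.comp_apply, RingHom.comp_apply, Ideal.Quotient.mk_eq_mk_iff_sub_mem,
    ← neg_mem_iff, neg_sub, Ideal.mem_span_singleton]
  have := map_dvd σ.symm (hass.symm.dvd.trans hP)
  simpa using this

theorem isNoetherianRing_of_quotient {R : Type*} [CommRing R]
    (h : ∀ g : R, g ≠ 0 → IsNoetherianRing (R ⧸ Ideal.span {g})) : IsNoetherianRing R := by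
  refine isNoetherianRing_iff_ideal_fg R |>.2 fun I => ?_
  by_cases hI : I = ⊥
  · rw [hI]
    exact Submodule.fg_bot
  obtain ⟨g, hgI, hg⟩ := Submodule.exists_mem_ne_zero_of_ne_bot hI
  have := h g hg
  refine Ideal.fg_of_fg_map_of_fg_inf_ker_of_surjective
    (f := Ideal.Quotient.mk (Ideal.span {g})) (IsNoetherian.noetherian _) ?_
    Ideal.Quotient.mk_surjective
  rw [Ideal.mk_ker, inf_eq_right.2 ((Ideal.span_singleton_le_iff_mem I).2 hgI)]
  exact ⟨{g}, by simp⟩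

instance isDomain_formalRing (n : ℕ) : IsDomain (FormalRing n) := NoZeroDivisors.to_isDomain _

theorem ufm_of_irreducible_prime {R : Type*} [CommRing R] [IsDomain R] [IsNoetherianRing R]
    (h : ∀ g : R, Irreducible g → Prime g) : UniqueFactorizationMonoid R where
  wf := (inferInstance : WfDvdMonoid R).wf
  irreducible_iff_prime := fun {a} => ⟨h a, Prime.irreducible⟩

theorem isUnit_convergentIn_empty {n : ℕ} {g : convergentIn (∅ : Finset (Fin n))} (hg : g ≠ 0) :
    IsUnit g := by
  refine isUnit_convergentIn g fun h => hg (Subtype.ext (MvPowerSeries.ext fun d => ?_))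
  by_cases hd : d = 0
  · subst hd
    exact h
  · exact g.2.2 d (by simpa using hd)

/-- Induction on the number of variables: the ring of convergent series in all variables but one
is Noetherian and factorial, and Weierstrass division and preparation transfer both properties. -/
theorem isNoetherianRing_and_ufm_convergentIn {n : ℕ} (s : Finset (Fin n)) :
    IsNoetherianRing (convergentIn s) ∧ UniqueFactorizationMonoid (convergentIn s) := by
  suffices h : IsNoetherianRing (convergentIn s) ∧
      ∀ g : convergentIn s, Irreducible g → Prime g by
    have := h.1
    exact ⟨h.1, ufm_of_irreducible_prime h.2⟩
  induction s using Finset.strongInduction with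
  | H s ih =>
    rcases s.eq_empty_or_nonempty with rfl | ⟨t, ht⟩
    · refine ⟨isNoetherianRing_of_quotient fun g hg => ?_, fun g hg =>
        absurd (isUnit_convergentIn_empty hg.ne_zero) hg.not_isUnit⟩
      have := Ideal.Quotient.subsingleton_iff.2
        (Ideal.span_singleton_eq_top.2 (isUnit_convergentIn_empty hg))
      infer_instance
    · obtain ⟨h1, h2⟩ := ih (s.erase t) (erase_ssubset ht)
      have : UniqueFactorizationMonoid (convergentIn (s.erase t)) := ufm_of_irreducible_prime h2
      refine ⟨isNoetherianRing_of_quotient fun g hg => isNoetherianRing_quotient ht hg,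
        fun g hg => ?_⟩
      obtain ⟨σ, hσ⟩ := exists_ringEquiv_regular ht hg.ne_zero
      rw [← MulEquiv.prime_iff σ]
      exact prime_of_irreducible_of_regular ht ((MulEquiv.irreducible_iff σ).2 hg) hσ

instance isNoetherianRing_convergentRing (n : ℕ) : IsNoetherianRing (ConvergentRing n) :=
  convergentIn_univ n ▸ (isNoetherianRing_and_ufm_convergentIn univ).1

instance uniqueFactorizationMonoid_convergentRing (n : ℕ) :
    UniqueFactorizationMonoid (ConvergentRing n) :=
  convergentIn_univ n ▸ (isNoetherianRing_and_ufm_convergentIn univ).2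

/-! ### Powers of the maximal ideals -/

/-- The coefficients `gᵢ` in the Euler decomposition `g = ∑ gᵢ xᵢ` of a series without constant
term: `gᵢ` is the partial derivative of `g`, divided in each degree by the degree. -/
noncomputable def eulerPart {n : ℕ} (i : Fin n) (g : FormalRing n) : FormalRing n :=
  fun e => coeff (e + Finsupp.single i 1) g * (((e i + 1 : ℕ) : ℂ) / ((e.degree + 1 : ℕ) : ℂ))

theorem coeff_eulerPart {n : ℕ} (i : Fin n) (g : FormalRing n) (e : Fin n →₀ ℕ) :
    coeff e (eulerPart i g) =
      coeff (e + Finsupp.single i 1) g * (((e i + 1 : ℕ) : ℂ) / ((e.degree + 1 : ℕ) : ℂ)) := rfl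

theorem sum_eulerPart_mul_X {n : ℕ} {g : FormalRing n} (hg : constantCoeff g = 0) :
    ∑ i, eulerPart i g * X i = g := by
  classical
  ext e
  rw [map_sum]
  have h1 : ∀ i, coeff e (eulerPart i g * X i) = coeff e g * ((e i : ℂ) / (e.degree : ℂ)) := by
    intro i
    have := coeff_mul_X_pow i 1 (eulerPart i g) e
    rw [pow_one] at this
    rw [this]
    split_ifs with h
    · have hle : Finsupp.single i 1 ≤ e := Finsupp.single_le_iff.2 h
      have hdeg : (e - Finsupp.single i 1).degree + 1 = e.degree := by
        conv_rhs => rw [← tsub_add_cancel_of_le hle, map_add]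
        simp
      rw [coeff_eulerPart, tsub_add_cancel_of_le hle, hdeg]
      have : (e - Finsupp.single i 1 : Fin n →₀ ℕ) i + 1 = e i := by
        simp only [Finsupp.coe_tsub, Pi.sub_apply, Finsupp.single_eq_same]
        omega
      rw [this]
    · have : e i = 0 := by omega
      simp [this]
  simp_rw [h1]
  rw [← mul_sum, ← sum_div, ← Nat.cast_sum, ← Finsupp.degree_eq_sum]
  by_cases he : e = 0
  · subst he
    simp [hg]
  · rw [div_self, mul_one]
    exact_mod_cast fun h => he ((Finsupp.degree_eq_zero_iff e).1 h)

theorem isConvergent_eulerPart {n : ℕ} (i : Fin n) {g : FormalRing n} (hg : IsConvergent g) :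
    IsConvergent (eulerPart i g) := by
  rw [← show g ∈ convergentIn univ ↔ IsConvergent g by rw [convergentIn_univ]; rfl] at hg
  obtain ⟨r, hr, h⟩ := (isConvergent_iff_polydiscNorm _).1 (divXPow_mem_convergentIn i 1 hg).1
  refine isConvergent_of_polydiscNorm (fun _ => hr) (ne_top_of_le_ne_top h
    (polydiscNorm_le_of_coeff_le _ fun d => ?_))
  rw [coeff_eulerPart, enorm_mul, coeff_divXPow]
  refine mul_le_of_le_one_right' ?_
  rw [enorm_eq_nnnorm, ← ENNReal.coe_one, ENNReal.coe_le_coe, ← NNReal.coe_le_coe, coe_nnnorm,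
    NNReal.coe_one, norm_div, Complex.norm_natCast, Complex.norm_natCast]
  refine div_le_one_of_le₀ ?_ (by positivity)
  have : d i ≤ d.degree := Finsupp.le_degree i d
  exact_mod_cast Nat.succ_le_succ this

theorem coeff_mul_eq_zero_of_degree {n : ℕ} {f g : FormalRing n} {k l : ℕ}
    (hf : ∀ d : Fin n →₀ ℕ, d.degree < k → coeff d f = 0)
    (hg : ∀ d : Fin n →₀ ℕ, d.degree < l → coeff d g = 0)
    (d : Fin n →₀ ℕ) (hd : d.degree < k + l) : coeff d (f * g) = 0 :=
  coeff_mul_eq_zero_of_weight (w := Finsupp.degree) (fun a b => map_add _ a b) hf hg d hd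

theorem coeff_eq_zero_of_degree_lt_one {n : ℕ} {f : FormalRing n} (hf : constantCoeff f = 0)
    (d : Fin n →₀ ℕ) (hd : d.degree < 1) : coeff d f = 0 := by
  rw [(Finsupp.degree_eq_zero_iff d).1 (by omega)]
  exact hf

theorem coeff_eulerPart_eq_zero {n : ℕ} {g : FormalRing n} {k : ℕ}
    (hg : ∀ d : Fin n →₀ ℕ, d.degree < k + 1 → coeff d g = 0) (i : Fin n)
    (d : Fin n →₀ ℕ) (hd : d.degree < k) : coeff d (eulerPart i g) = 0 := by
  rw [coeff_eulerPart, hg, zero_mul]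
  simpa using hd

theorem mem_formalMaxIdeal_pow {n : ℕ} {k : ℕ} {g : FormalRing n} :
    g ∈ formalMaxIdeal n ^ k ↔ ∀ d : Fin n →₀ ℕ, d.degree < k → coeff d g = 0 := by
  constructor
  · intro hg
    induction k generalizing g with
    | zero => simp
    | succ k ih =>
      rw [pow_succ] at hg
      refine Submodule.mul_induction_on hg (fun a ha b hb => ?_) fun a b ha hb d hd => ?_
      · refine coeff_mul_eq_zero_of_degree (ih ha) (coeff_eq_zero_of_degree_lt_one ?_)
        have : formalMaxIdeal n ≤ RingHom.ker (constantCoeff (σ := Fin n) (R := ℂ)) := by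
          rw [formalMaxIdeal, Ideal.span_le]
          rintro _ ⟨i, rfl⟩
          simp
        exact this hb
      · rw [map_add, ha d hd, hb d hd, add_zero]
  · intro hg
    induction k generalizing g with
    | zero => simp
    | succ k ih =>
      rw [← sum_eulerPart_mul_X (g := g) (hg 0 (by simp)), pow_succ]
      exact Submodule.sum_mem _ fun i _ => Ideal.mul_mem_mul (ih (coeff_eulerPart_eq_zero hg i))
        (Ideal.subset_span ⟨i, rfl⟩)

theorem mem_convergentMaxIdeal_pow {n : ℕ} {k : ℕ} {g : ConvergentRing n} :
    g ∈ convergentMaxIdeal n ^ k ↔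
      ∀ d : Fin n →₀ ℕ, d.degree < k → coeff d (g : FormalRing n) = 0 := by
  constructor
  · intro hg
    rw [← mem_formalMaxIdeal_pow]
    have h1 : (convergentMaxIdeal n).map (ConvergentRing n).val.toRingHom ≤ formalMaxIdeal n := by
      rw [convergentMaxIdeal, Ideal.map_span, Ideal.span_le]
      rintro _ ⟨_, ⟨i, rfl⟩, rfl⟩
      exact Ideal.subset_span ⟨i, rfl⟩
    have h2 := Ideal.mem_map_of_mem (ConvergentRing n).val.toRingHom hg
    rw [Ideal.map_pow] at h2
    exact Ideal.pow_right_mono h1 k h2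
  · intro hg
    induction k generalizing g with
    | zero => simp
    | succ k ih =>
      have : ∑ i, (⟨eulerPart i (g : FormalRing n), isConvergent_eulerPart i g.2⟩ *
          convergentX i : ConvergentRing n) = g := by
        refine Subtype.ext ?_
        rw [AddSubmonoidClass.coe_finsetSum]
        exact sum_eulerPart_mul_X (hg 0 (by simp))
      rw [← this, pow_succ]
      exact Submodule.sum_mem _ fun i _ => Ideal.mul_mem_mul (ih (coeff_eulerPart_eq_zero hg i))
        (Ideal.subset_span ⟨i, rfl⟩)

theorem eq_zero_of_forall_mem_formalMaxIdeal_pow {n : ℕ} {g : FormalRing n}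
    (h : ∀ k, g ∈ formalMaxIdeal n ^ k) : g = 0 := by
  ext d
  exact mem_formalMaxIdeal_pow.1 (h (d.degree + 1)) d (by omega)

theorem coe_aeval_convergentX {n : ℕ} (p : MvPolynomial (Fin n) ℂ) :
    (MvPolynomial.aeval convergentX p : ConvergentRing n) = (p : FormalRing n) := by
  have : (ConvergentRing n).val.comp (MvPolynomial.aeval convergentX) =
      MvPolynomial.coeToMvPowerSeries.algHom ℂ := by
    ext i
    simp [convergentX]
  have h := DFunLike.congr_fun this p
  simpa using h

theorem sub_truncTotal_mem {n : ℕ} (g : FormalRing n) (k : ℕ) :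
    g - (truncTotal k g : MvPolynomial (Fin n) ℂ) ∈ formalMaxIdeal n ^ k := by
  rw [mem_formalMaxIdeal_pow]
  intro d hd
  rw [map_sub, MvPolynomial.coeff_coe, coeff_truncTotal _ hd, sub_self]

/-- Every formal power series is approximated by polynomials, as convergent series. -/
theorem exists_convergent_sub_mem {n : ℕ} (g : FormalRing n) (k : ℕ) :
    ∃ p : ConvergentRing n, g - (p : FormalRing n) ∈ formalMaxIdeal n ^ k :=
  ⟨MvPolynomial.aeval convergentX (truncTotal k g), by
    rw [coe_aeval_convergentX]
    exact sub_truncTotal_mem g k⟩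

/-! ### Derivations of rings of power series -/

theorem derivation_apply_mem_pow {A : Type*} [CommRing A] [Algebra ℂ A] (E : Derivation ℂ A A)
    (I : Ideal A) (k : ℕ) {a : A} (ha : a ∈ I ^ (k + 1)) : E a ∈ I ^ k := by
  induction k generalizing a with
  | zero => simp
  | succ k ih =>
    rw [pow_succ] at ha
    refine Submodule.mul_induction_on ha (fun x hx y hy => ?_) fun x y hx hy => ?_
    · rw [Derivation.leibniz, smul_eq_mul, smul_eq_mul]
      refine Ideal.add_mem _ (Ideal.mul_mem_right _ _ hx) ?_
      rw [pow_succ']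
      exact Ideal.mul_mem_mul hy (ih hx)
    · rw [map_add]
      exact Ideal.add_mem _ hx hy

theorem derivation_aeval_eq_zero {σ A : Type*} [CommRing A] [Algebra ℂ A] (E : Derivation ℂ A A)
    (x : σ → A) (hx : ∀ i, E (x i) = 0) (p : MvPolynomial σ ℂ) :
    E (MvPolynomial.aeval x p) = 0 := by
  induction p using MvPolynomial.induction_on with
  | C a => simp
  | add p q hp hq => rw [map_add, map_add, hp, hq, add_zero]
  | mul_X p i hp => simp [hp, hx]

theorem derivation_sum_smul_apply {ι A : Type*} [Fintype ι] [CommRing A] [Algebra ℂ A]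
    (a : ι → A) (D : ι → Derivation ℂ A A) (g : A) :
    (∑ i, a i • D i) g = ∑ i, a i * D i g := by
  refine (congrFun (map_sum Derivation.coeFnAddMonoidHom (fun i => a i • D i) univ) g).trans ?_
  rw [Finset.sum_apply]
  rfl

/-- A derivation of `ℂ[[x₁, …, xₙ]]` is determined by its values on the coordinates: it lowers the
order by at most one, so that it is continuous. -/
theorem derivation_formal_ext {n : ℕ} {D E : Derivation ℂ (FormalRing n) (FormalRing n)}
    (h : ∀ i, D (X i) = E (X i)) : D = E := by
  rw [← sub_eq_zero]
  ext1 g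
  refine eq_zero_of_forall_mem_formalMaxIdeal_pow fun k => ?_
  have h1 := derivation_apply_mem_pow (D - E) _ k (sub_truncTotal_mem g (k + 1))
  have h2 := derivation_aeval_eq_zero (D - E) (X : Fin n → FormalRing n) (by simp [h])
    (truncTotal (k + 1) g)
  have h3 : (MvPolynomial.aeval (X : Fin n → FormalRing n) (truncTotal (k + 1) g)) =
      ((truncTotal (k + 1) g : MvPolynomial (Fin n) ℂ) : FormalRing n) := by
    have : (MvPolynomial.aeval (X : Fin n → FormalRing n) :
        MvPolynomial (Fin n) ℂ →ₐ[ℂ] FormalRing n) =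
        MvPolynomial.coeToMvPowerSeries.algHom ℂ := by
      ext i
      simp
    rw [this]
    simp
  rwa [map_sub, ← h3, h2, sub_zero] at h1

theorem derivation_convergent_ext {n : ℕ} {D E : Derivation ℂ (ConvergentRing n) (ConvergentRing n)}
    (h : ∀ i, D (convergentX i) = E (convergentX i)) : D = E := by
  rw [← sub_eq_zero]
  ext1 g
  refine Subtype.ext (eq_zero_of_forall_mem_formalMaxIdeal_pow fun k => ?_)
  obtain ⟨p, hp⟩ : ∃ p : MvPolynomial (Fin n) ℂ,
      g - MvPolynomial.aeval convergentX p ∈ convergentMaxIdeal n ^ (k + 1) := by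
    refine ⟨truncTotal (k + 1) (g : FormalRing n), ?_⟩
    rw [mem_convergentMaxIdeal_pow, Subalgebra.coe_sub, coe_aeval_convergentX]
    exact mem_formalMaxIdeal_pow.1 (sub_truncTotal_mem (g : FormalRing n) (k + 1))
  have h1 := derivation_apply_mem_pow (D - E) _ k hp
  rw [map_sub, derivation_aeval_eq_zero (D - E) convergentX (by simp [h]), sub_zero,
    mem_convergentMaxIdeal_pow] at h1
  exact mem_formalMaxIdeal_pow.2 h1

/-- The coefficients of the derivative grow by the factors `dᵢ + 1 ≤ 2 ^ |d|`, which are absorbed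
by halving the radius. -/
theorem isConvergent_pderiv {n : ℕ} (i : Fin n) {g : FormalRing n} (hg : IsConvergent g) :
    IsConvergent (pderiv ℂ i g) := by
  rw [← show g ∈ convergentIn univ ↔ IsConvergent g by rw [convergentIn_univ]; rfl] at hg
  obtain ⟨r, hr, h⟩ := (isConvergent_iff_polydiscNorm _).1 (divXPow_mem_convergentIn i 1 hg).1
  refine isConvergent_of_polydiscNorm (ρ := fun _ => r / 2) (fun _ => by positivity)
    (ne_top_of_le_ne_top h (ENNReal.tsum_le_tsum fun d => ?_))
  rw [coeff_pderiv, coeff_divXPow, enorm_mul, mul_assoc]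
  gcongr
  rw [radiusMonomial_const, radiusMonomial_const, enorm_eq_nnnorm, ← ENNReal.coe_mul,
    ENNReal.coe_le_coe, div_pow]
  have h1 : ‖((d i : ℂ) + 1)‖₊ ≤ 2 ^ d.degree := by
    have h2 : ‖((d i : ℂ) + 1)‖₊ = ((d i + 1 : ℕ) : ℝ≥0) := by
      rw [← Complex.nnnorm_natCast (d i + 1)]
      push_cast
      rfl
    rw [h2]
    have : d i + 1 ≤ 2 ^ d.degree :=
      (Nat.succ_le_of_lt Nat.lt_two_pow_self).trans
        (Nat.pow_le_pow_right two_pos (Finsupp.le_degree i d))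
    exact_mod_cast this
  calc ‖((d i : ℂ) + 1)‖₊ * (r ^ d.degree / 2 ^ d.degree)
      ≤ 2 ^ d.degree * (r ^ d.degree / 2 ^ d.degree) := by gcongr
    _ = r ^ d.degree := mul_div_cancel₀ _ (by positivity)

/-- The partial derivative of convergent power series. -/
noncomputable def convergentPderiv {n : ℕ} (i : Fin n) :
    Derivation ℂ (ConvergentRing n) (ConvergentRing n) :=
  Derivation.mk' ((pderiv ℂ i).toLinearMap.restrict
      (p := Subalgebra.toSubmodule (ConvergentRing n))
      (q := Subalgebra.toSubmodule (ConvergentRing n)) fun _ hg => isConvergent_pderiv i hg)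
    fun a b => Subtype.ext ((pderiv ℂ i).leibniz (a : FormalRing n) (b : FormalRing n))

theorem coe_convergentPderiv {n : ℕ} (i : Fin n) (g : ConvergentRing n) :
    (convergentPderiv i g : FormalRing n) = pderiv ℂ i (g : FormalRing n) := rfl

theorem convergentPderiv_X {n : ℕ} (i j : Fin n) :
    convergentPderiv i (convergentX j) = if i = j then 1 else 0 := by
  refine Subtype.ext ?_
  rw [coe_convergentPderiv, convergentX]
  dsimp only
  rw [pderiv_X, Pi.single_apply]
  by_cases h : i = j
  · simp [h]
  · simp [h, Ne.symm h]

theorem pderiv_X_eq {n : ℕ} (i j : Fin n) :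
    pderiv ℂ i (X j : FormalRing n) = if i = j then 1 else 0 :=
  congrArg Subtype.val (convergentPderiv_X i j) |>.trans (by split_ifs <;> rfl)

/-- Derivations of `ℂ{x₁, …, xₙ}` as vectors of coefficients with respect to the partial
derivatives. -/
noncomputable def convergentDerivationEquiv (n : ℕ) :
    Derivation ℂ (ConvergentRing n) (ConvergentRing n) ≃ₗ[ConvergentRing n]
      (Fin n → ConvergentRing n) where
  toFun D i := D (convergentX i)
  map_add' _ _ := rfl
  map_smul' _ _ := rfl
  invFun a := ∑ i, a i • convergentPderiv i
  left_inv D := derivation_convergent_ext fun j => by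
    simp [derivation_sum_smul_apply, convergentPderiv_X]
  right_inv a := by
    funext j
    simp [derivation_sum_smul_apply, convergentPderiv_X]

theorem convergentDerivation_apply {n : ℕ}
    (D : Derivation ℂ (ConvergentRing n) (ConvergentRing n)) (g : ConvergentRing n) :
    D g = ∑ i, D (convergentX i) * convergentPderiv i g := by
  conv_lhs => rw [← (convergentDerivationEquiv n).left_inv D]
  change (∑ i, D (convergentX i) • convergentPderiv i) g = _
  simp [derivation_sum_smul_apply]

theorem formalDerivation_eq {n : ℕ} (D : Derivation ℂ (FormalRing n) (FormalRing n)) :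
    D = ∑ i, D (X i) • pderiv ℂ i :=
  derivation_formal_ext fun j => by simp [derivation_sum_smul_apply, pderiv_X_eq]

theorem formalDerivation_apply {n : ℕ} (D : Derivation ℂ (FormalRing n) (FormalRing n))
    (g : FormalRing n) : D g = ∑ i, D (X i) * pderiv ℂ i g := by
  conv_lhs => rw [formalDerivation_eq D]
  simp [derivation_sum_smul_apply]

/-! ### The criterion of Saito -/

theorem mem_logDer {A : Type} [CommRing A] [Algebra ℂ A] {f : A} {δ : Derivation ℂ A A} :
    δ ∈ logDer f ↔ f ∣ δ f := Ideal.mem_span_singleton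

/-- A prime element of `ℂ{x₁, …, xₙ}` does not divide all of its partial derivatives, since
differentiation lowers the order. -/
theorem exists_not_dvd_convergentPderiv {n : ℕ} {p : ConvergentRing n} (hp : Prime p) :
    ∃ j, ¬ p ∣ convergentPderiv j p := by
  classical
  have hp0 : (p : FormalRing n) ≠ 0 := fun h => hp.ne_zero (Subtype.ext h)
  obtain ⟨d, hd, hdm⟩ := exists_coeff_ne_zero_and_order (ne_zero_iff_order_finite.mp hp0)
  have hlow : ∀ e : Fin n →₀ ℕ, e.degree < d.degree → coeff e (p : FormalRing n) = 0 := fun e he =>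
    coeff_of_lt_order (by rw [← hdm]; exact_mod_cast he)
  have hd0 : d ≠ 0 := by
    rintro rfl
    refine hp.not_isUnit (IsUnit.of_mul_eq_one ⟨_, ?_⟩ (Subtype.ext
      (MvPowerSeries.mul_inv_cancel _ hd)))
    have := inv_mem_convergentIn (s := univ) (f := (p : FormalRing n))
      (by rw [convergentIn_univ]; exact p.2) hd
    rwa [convergentIn_univ] at this
  obtain ⟨j, hj⟩ := Finsupp.ne_iff.mp hd0
  have hle : Finsupp.single j 1 ≤ d := Finsupp.single_le_iff.2 (Nat.one_le_iff_ne_zero.2 hj)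
  refine ⟨j, fun ⟨q, hq⟩ => ?_⟩
  have h1 := congrArg (fun g : ConvergentRing n =>
    coeff (d - Finsupp.single j 1) (g : FormalRing n)) hq
  have hdeg : (d - Finsupp.single j 1).degree + 1 = d.degree := by
    conv_rhs => rw [← tsub_add_cancel_of_le hle, map_add]
    simp
  rw [coe_convergentPderiv, coeff_pderiv, tsub_add_cancel_of_le hle, Subalgebra.coe_mul,
    coeff_mul_eq_zero_of_degree (l := 0) hlow (by simp) _ (by omega)] at h1
  refine mul_ne_zero hd ?_ h1
  exact Nat.cast_add_one_ne_zero _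

theorem dvd_of_squarefree_of_forall_prime {R : Type*} [CommRing R] [IsDomain R]
    [UniqueFactorizationMonoid R] {f D : R} (hf : Squarefree f)
    (h : ∀ p, Prime p → p ∣ f → p ∣ D) : f ∣ D := by
  induction f using UniqueFactorizationMonoid.induction_on_prime with
  | h₁ => exact absurd rfl hf.ne_zero
  | h₂ u hu => exact hu.dvd
  | h₃ a p ha hp ih =>
    obtain ⟨e, rfl⟩ := ih (hf.squarefree_of_dvd (dvd_mul_left a p))
      fun q hq hqa => h q hq (hqa.mul_left p)
    have hpa : ¬ p ∣ a := fun hpa => hp.not_isUnit (hf p (mul_dvd_mul_left p hpa))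
    rw [mul_comm p a]
    exact mul_dvd_mul_left a
      ((hp.dvd_or_dvd (h p hp (dvd_mul_right p a))).resolve_left hpa)

/-- If no prime factor of the squarefree element `f` divides all the `yⱼ`, then `f` is
characterised up to units by the divisibilities satisfied by a Saito determinant. -/
theorem associated_of_dvd {R : Type*} [CommRing R] [IsDomain R] [UniqueFactorizationMonoid R]
    {ι : Type*} {f D : R} {y : ι → R} {k : ℕ} (hf : Squarefree f)
    (hy : ∀ p, Prime p → p ∣ f → ∃ j, ¬ p ∣ y j) (h1 : ∀ j, f ∣ D * y j) (h2 : D ∣ f ^ k)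
    (h3 : ∀ j, D ∣ f * y j ^ k) : Associated f D := by
  have hf0 : f ≠ 0 := hf.ne_zero
  obtain ⟨h, rfl⟩ : f ∣ D := dvd_of_squarefree_of_forall_prime hf fun p hp hpf => by
    obtain ⟨j, hj⟩ := hy p hp hpf
    exact (hp.dvd_or_dvd (hpf.trans (h1 j))).resolve_right hj
  by_contra hna
  have hh : ¬ IsUnit h := fun hh => hna ⟨hh.unit, rfl⟩
  have hh0 : h ≠ 0 := by
    rintro rfl
    rw [mul_zero, zero_dvd_iff] at h2
    exact pow_ne_zero k hf0 h2
  obtain ⟨p, hp, hph⟩ := WfDvdMonoid.exists_irreducible_factor hh hh0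
  have hpf : p ∣ f := hp.prime.dvd_of_dvd_pow ((hph.mul_left f).trans h2)
  obtain ⟨j, hj⟩ := hy p hp.prime hpf
  have := (mul_dvd_mul_iff_left hf0).1 (h3 j)
  exact hj (hp.prime.dvd_of_dvd_pow (hph.trans this))

theorem exists_not_dvd_convergentPderiv_of_squarefree {n : ℕ} {f p : ConvergentRing n}
    (hf : Squarefree f) (hp : Prime p) (hpf : p ∣ f) : ∃ j, ¬ p ∣ convergentPderiv j f := by
  obtain ⟨q, rfl⟩ := hpf
  have hpq : ¬ p ∣ q := fun h => hp.not_isUnit (hf p (mul_dvd_mul_left p h))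
  obtain ⟨j, hj⟩ := exists_not_dvd_convergentPderiv hp
  refine ⟨j, fun h => ?_⟩
  rw [Derivation.leibniz, smul_eq_mul, smul_eq_mul, dvd_add_right (dvd_mul_right p _)] at h
  exact (hp.dvd_or_dvd h).elim hpq hj

/-- The Saito matrix `(δᵢ(xⱼ))ᵢⱼ` of a family of derivations of `ℂ{x₁, …, xₙ}`. -/
noncomputable def convergentSaitoMatrix {n : ℕ}
    (δ : Fin n → Derivation ℂ (ConvergentRing n) (ConvergentRing n)) :
    Matrix (Fin n) (Fin n) (ConvergentRing n) :=
  Matrix.of fun i j => δ i (convergentX j)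

/-- A free module of logarithmic derivations has rank `n`, since `f • Der ⊆ Der_f ⊆ Der`. -/
theorem exists_basis_logDer {n : ℕ} {f : ConvergentRing n} (hf : f ≠ 0)
    [Module.Free (ConvergentRing n) (logDer f)] :
    Nonempty (Module.Basis (Fin n) (ConvergentRing n) (logDer f)) := by
  have e := convergentDerivationEquiv n
  have : Module.Finite (ConvergentRing n)
      (Derivation ℂ (ConvergentRing n) (ConvergentRing n)) := Module.Finite.equiv e.symm
  have : IsNoetherian (ConvergentRing n)
      (Derivation ℂ (ConvergentRing n) (ConvergentRing n)) :=
    isNoetherian_of_linearEquiv e.symm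
  have : Module.Finite (ConvergentRing n) (logDer f) := Module.IsNoetherian.finite _ _
  have hrank : Module.finrank (ConvergentRing n)
      (Derivation ℂ (ConvergentRing n) (ConvergentRing n)) = n := by
    rw [e.finrank_eq, Module.finrank_fin_fun]
  let φ : Derivation ℂ (ConvergentRing n) (ConvergentRing n) →ₗ[ConvergentRing n] logDer f :=
    (LinearMap.lsmul _ _ f).codRestrict _ fun D => mem_logDer.2 (dvd_mul_right f (D f))
  have hφ : Function.Injective φ := by
    rw [injective_iff_map_eq_zero]
    intro D hD
    have h1 : f • D = 0 := congrArg Subtype.val hD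
    ext1 g
    have h2 : f * D g = 0 := congrArg (fun E => E g) h1
    exact (mul_eq_zero.1 h2).resolve_left hf
  have h1 := LinearMap.finrank_le_finrank_of_injective hφ
  have h2 := LinearMap.finrank_le_finrank_of_injective (logDer f).injective_subtype
  exact ⟨Module.finBasisOfFinrankEq _ _ (le_antisymm (h2.trans hrank.le) (hrank.ge.trans h1))⟩

theorem exists_sum_mul_of_dvd {n : ℕ} {f : ConvergentRing n}
    (b : Module.Basis (Fin n) (ConvergentRing n) (logDer f)) (u : Fin n → ConvergentRing n)
    (hu : f ∣ ∑ j, u j * convergentPderiv j f) :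
    ∃ z : Fin n → ConvergentRing n, ∀ j, u j = ∑ i, z i * (b i).1 (convergentX j) := by
  have hmem : ∑ j, u j • convergentPderiv j ∈ logDer f := by
    rw [mem_logDer, derivation_sum_smul_apply]
    exact hu
  refine ⟨fun i => b.repr ⟨_, hmem⟩ i, fun j => ?_⟩
  have h1 := congrArg Subtype.val (b.sum_repr ⟨_, hmem⟩)
  have h2 := congrArg (fun D => D (convergentX j)) h1
  simp only [AddSubmonoidClass.coe_finsetSum, Submodule.coe_smul] at h2
  rw [derivation_sum_smul_apply, derivation_sum_smul_apply] at h2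
  rw [h2]
  simp [convergentPderiv_X]

/-- The Saito determinant of a basis divides the determinant of any matrix whose rows are the
coefficients of logarithmic derivations. -/
theorem det_dvd_of_rows {n : ℕ} {f : ConvergentRing n}
    (b : Module.Basis (Fin n) (ConvergentRing n) (logDer f))
    (C : Matrix (Fin n) (Fin n) (ConvergentRing n))
    (hC : ∀ i, f ∣ ∑ j, C i j * convergentPderiv j f) :
    (convergentSaitoMatrix fun i => (b i).1).det ∣ C.det := by
  choose z hz using fun i => exists_sum_mul_of_dvd b (C i) (hC i)
  have : C = Matrix.of z * convergentSaitoMatrix fun i => (b i).1 := by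
    ext i j
    rw [hz, Matrix.mul_apply]
    rfl
  rw [this, Matrix.det_mul]
  exact dvd_mul_left _ _

/-- The criterion of Saito: if `f` is reduced, the determinant of the Saito matrix of a basis of
the module of logarithmic derivations is `f` up to a unit. -/
theorem associated_det_convergentSaitoMatrix {n : ℕ} {f : ConvergentRing n} (hf : Squarefree f)
    (b : Module.Basis (Fin n) (ConvergentRing n) (logDer f)) :
    Associated f (convergentSaitoMatrix fun i => (b i).1).det := by
  classical
  refine associated_of_dvd (y := fun j => convergentPderiv j f) (k := n) hf
    (fun p hp hpf => exists_not_dvd_convergentPderiv_of_squarefree hf hp hpf) ?_ ?_ ?_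
  · set A := convergentSaitoMatrix fun i => (b i).1 with hA
    have h1 : ∀ i, f ∣ ∑ j, A i j * convergentPderiv j f := by
      intro i
      have := mem_logDer.1 (b i).2
      rwa [convergentDerivation_apply] at this
    choose c hc using h1
    intro j
    -- Multiplication by the adjugate matrix in `A (∂f) = f c`.
    have h2 : A.mulVec (fun j => convergentPderiv j f) = f • c := by
      funext i
      exact hc i
    have h3 := congrArg (fun w => A.adjugate.mulVec w j) h2
    simp only [Matrix.mulVec_mulVec, Matrix.adjugate_mul, Matrix.smul_mulVec, Matrix.one_mulVec,
      Matrix.mulVec_smul, Pi.smul_apply, smul_eq_mul] at h3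
    exact ⟨_, h3⟩
  · have h1 : ((f • 1 : Matrix (Fin n) (Fin n) (ConvergentRing n))).det = f ^ n := by
      rw [Matrix.det_smul, Matrix.det_one, mul_one, Fintype.card_fin]
    rw [← h1]
    refine det_dvd_of_rows b _ fun i => dvd_sum fun j _ => ?_
    rw [Matrix.smul_apply, smul_eq_mul, mul_assoc]
    exact dvd_mul_right _ _
  · -- The derivations `(∂ⱼf)∂ᵢ - (∂ᵢf)∂ⱼ`, for `i ≠ j`, and `f∂ⱼ` are logarithmic.
    intro j
    set y : Fin n → ConvergentRing n := fun j => convergentPderiv j f with hy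
    let M (r : ConvergentRing n) : Matrix (Fin n) (Fin n) (ConvergentRing n) :=
      Matrix.updateRow (Matrix.of fun i k => (if i = k then y j else 0) - if j = k then y i else 0)
        j (r • fun k => if j = k then 1 else 0)
    have hM : (M f).det = f * ∏ i, if i = j then 1 else y j := by
      have h1 : (M f).det = f * (M 1).det := by
        simp only [M, one_smul]
        rw [Matrix.det_updateRow_smul]
      rw [h1, ← Matrix.det_diagonal]
      congr 1
      refine Matrix.det_eq_of_forall_row_eq_smul_add_const
        (fun i => if i = j then 0 else - y i) j (by simp) fun i k => ?_
      by_cases hi : i = j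
      · subst hi
        simp [M, Matrix.diagonal_apply]
      · by_cases hk : j = k
        · subst hk
          simp [M, hi]
        · simp [M, Matrix.diagonal_apply, hi, hk]
    have hdvd : (M f).det ∣ f * y j ^ n := by
      rw [hM]
      refine mul_dvd_mul_left f ?_
      have : y j ^ n = ∏ _i : Fin n, y j := by simp
      rw [this]
      refine prod_dvd_prod_of_dvd _ _ fun i _ => ?_
      split_ifs
      exacts [one_dvd _, dvd_rfl]
    refine (det_dvd_of_rows b (M f) fun i => ?_).trans hdvd
    by_cases hi : i = j
    · subst hi
      simp [M]
    · simp only [M, Matrix.updateRow_ne hi, Matrix.of_apply, sub_mul, sum_sub_distrib, ite_mul,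
        zero_mul, sum_ite_eq, mem_univ, if_true]
      rw [show y j * convergentPderiv i f - y i * convergentPderiv j f = 0 by
        simp only [hy]; ring]
      exact dvd_zero f

/-! ### Formal logarithmic derivations -/

/-- The extension of a derivation of convergent power series to formal power series. -/
noncomputable def formalExtension {n : ℕ} (D : Derivation ℂ (ConvergentRing n) (ConvergentRing n)) :
    Derivation ℂ (FormalRing n) (FormalRing n) :=
  ∑ j, (D (convergentX j) : FormalRing n) • pderiv ℂ j

theorem formalExtension_coe {n : ℕ} (D : Derivation ℂ (ConvergentRing n) (ConvergentRing n))
    (g : ConvergentRing n) : formalExtension D (g : FormalRing n) = (D g : FormalRing n) := by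
  rw [formalExtension, derivation_sum_smul_apply, convergentDerivation_apply,
    AddSubmonoidClass.coe_finsetSum]
  rfl

theorem formalExtension_X {n : ℕ} (D : Derivation ℂ (ConvergentRing n) (ConvergentRing n))
    (j : Fin n) : formalExtension D (X j) = (D (convergentX j) : FormalRing n) :=
  formalExtension_coe D (convergentX j)

theorem formalMaxIdeal_ne_top (n : ℕ) : formalMaxIdeal n ≠ ⊤ := by
  intro h
  have h1 : (1 : FormalRing n) ∈ formalMaxIdeal n ^ 1 := by rw [pow_one, h]; trivial
  have := mem_formalMaxIdeal_pow.1 h1 0 (by simp)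
  simp at this

/-- A submodule of a finite module over `ℂ[[x₁, …, xₙ]]` is closed: by the intersection theorem of
Krull, it contains every vector that it approximates to all orders. -/
theorem mem_of_forall_exists_sub_mem {n : ℕ} {M : Type*} [AddCommGroup M] [Module (FormalRing n) M]
    [Module.Finite (FormalRing n) M] (N : Submodule (FormalRing n) M) {v : M}
    (h : ∀ k, ∃ u ∈ N, v - u ∈ formalMaxIdeal n ^ k • (⊤ : Submodule (FormalRing n) M)) :
    v ∈ N := by
  have key : N.mkQ v ∈ (⨅ i : ℕ, formalMaxIdeal n ^ i • ⊤ : Submodule (FormalRing n) (M ⧸ N)) := by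
    rw [Submodule.mem_iInf]
    intro k
    obtain ⟨u, hu, hvu⟩ := h k
    have h1 : N.mkQ v = N.mkQ (v - u) := by
      rw [map_sub, (Submodule.Quotient.mk_eq_zero N).2 hu |> fun h => (h : N.mkQ u = 0), sub_zero]
    have h2 := Submodule.mem_map_of_mem (f := N.mkQ) hvu
    rw [Submodule.map_smul''] at h2
    rw [h1]
    exact Submodule.smul_mono le_rfl le_top h2
  rw [Ideal.iInf_pow_smul_eq_bot_of_isLocalRing _ (formalMaxIdeal_ne_top n),
    Submodule.mem_bot] at key
  exact (Submodule.Quotient.mk_eq_zero N).1 key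

/-- Formal logarithmic derivations are approximated by convergent ones. This is where the lemma
of Artin and Rees enters, for the ideal generated by `f` and its partial derivatives. -/
theorem exists_convergent_approximation {n : ℕ} (f : ConvergentRing n) (v : Fin n → FormalRing n)
    (hv : (f : FormalRing n) ∣ ∑ j, v j * pderiv ℂ j (f : FormalRing n)) (k : ℕ) :
    ∃ u : Fin n → ConvergentRing n, f ∣ ∑ j, u j * convergentPderiv j f ∧
      ∀ j, v j - (u j : FormalRing n) ∈ formalMaxIdeal n ^ k := by
  obtain ⟨c, hc⟩ := hv
  let y : Option (Fin n) → ConvergentRing n := fun o => o.elim f fun j => convergentPderiv j f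
  obtain ⟨N, hN⟩ := Ideal.exists_pow_inf_eq_pow_smul (convergentMaxIdeal n)
    (Submodule.span (ConvergentRing n) (Set.range y))
  choose w hw using fun j => exists_convergent_sub_mem (v j) (N + k)
  obtain ⟨w₀, hw₀⟩ := exists_convergent_sub_mem c (N + k)
  have h1 : ∑ j, w j * convergentPderiv j f - w₀ * f ∈ convergentMaxIdeal n ^ (N + k) := by
    rw [mem_convergentMaxIdeal_pow, ← mem_formalMaxIdeal_pow, Subalgebra.coe_sub,
      AddSubmonoidClass.coe_finsetSum, Subalgebra.coe_mul]
    have : ∑ j, ((w j * convergentPderiv j f : ConvergentRing n) : FormalRing n) - w₀ * f =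
        (c - w₀) * f - ∑ j, (v j - w j) * pderiv ℂ j (f : FormalRing n) := by
      simp only [sub_mul, sum_sub_distrib, Subalgebra.coe_mul, coe_convergentPderiv]
      rw [hc]
      ring
    rw [this]
    exact Ideal.sub_mem _ (Ideal.mul_mem_right _ _ hw₀)
      (Ideal.sum_mem _ fun j _ => Ideal.mul_mem_right _ _ (hw j))
  have h2 : ∑ j, w j * convergentPderiv j f - w₀ * f ∈
      Submodule.span (ConvergentRing n) (Set.range y) := by
    refine Submodule.sub_mem _ (Submodule.sum_mem _ fun j _ => ?_) ?_
    · exact Submodule.smul_mem _ _ (Submodule.subset_span ⟨some j, rfl⟩)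
    · exact Submodule.smul_mem _ _ (Submodule.subset_span ⟨none, rfl⟩)
  have h3 : ∑ j, w j * convergentPderiv j f - w₀ * f ∈
      convergentMaxIdeal n ^ k • Submodule.span (ConvergentRing n) (Set.range y) := by
    have := hN (N + k) (by omega)
    rw [Nat.add_sub_cancel_left] at this
    have h4 : ∑ j, w j * convergentPderiv j f - w₀ * f ∈ convergentMaxIdeal n ^ (N + k) •
        (⊤ : Submodule (ConvergentRing n) (ConvergentRing n)) ⊓
          Submodule.span (ConvergentRing n) (Set.range y) := by
      refine ⟨?_, h2⟩
      rw [smul_eq_mul, Ideal.mul_top]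
      exact h1
    rw [this] at h4
    exact Submodule.smul_mono le_rfl inf_le_right h4
  rw [Submodule.mem_ideal_smul_span_iff_exists_sum] at h3
  obtain ⟨a, ha, hsum⟩ := h3
  rw [Finsupp.sum_fintype _ _ (by simp), Fintype.sum_option] at hsum
  simp only [smul_eq_mul, y, Option.elim] at hsum
  refine ⟨fun j => w j - a (some j), ⟨w₀ + a none, ?_⟩, fun j => ?_⟩
  · simp only [sub_mul, sum_sub_distrib]
    linear_combination -hsum
  · rw [Subalgebra.coe_sub, sub_sub_eq_add_sub, add_comm, add_sub_assoc, add_comm]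
    exact Ideal.add_mem _ (Ideal.pow_le_pow_right (Nat.le_add_left k N) (hw j))
      (mem_formalMaxIdeal_pow.2 (mem_convergentMaxIdeal_pow.1 (ha (some j))))

/-- A basis of the convergent logarithmic derivations generates the formal ones. -/
theorem span_formalExtension {n : ℕ} {f : ConvergentRing n}
    (b : Module.Basis (Fin n) (ConvergentRing n) (logDer f)) :
    Submodule.span (FormalRing n) (Set.range fun i => formalExtension (b i).1) =
      logDer (f : FormalRing n) := by
  refine le_antisymm (Submodule.span_le.2 ?_) fun η hη => ?_
  · rintro _ ⟨i, rfl⟩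
    rw [SetLike.mem_coe, mem_logDer]
    dsimp only
    rw [formalExtension_coe]
    exact map_dvd (ConvergentRing n).val (mem_logDer.1 (b i).2)
  · have hv := mem_logDer.1 hη
    rw [formalDerivation_apply] at hv
    have key : (fun j => η (X j)) ∈ Submodule.span (FormalRing n)
        (Set.range fun i => fun j => formalExtension (b i).1 (X j)) := by
      refine mem_of_forall_exists_sub_mem _ fun k => ?_
      obtain ⟨u, hu, hvu⟩ := exists_convergent_approximation f _ hv k
      obtain ⟨z, hz⟩ := exists_sum_mul_of_dvd b u hu
      refine ⟨fun j => u j, ?_, ?_⟩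
      swap
      · rw [pi_eq_sum_univ ((fun j => η (X j)) - fun j => (u j : FormalRing n))]
        exact Submodule.sum_mem _ fun j _ => Submodule.smul_mem_smul (hvu j) trivial
      have : (fun j => (u j : FormalRing n)) =
          ∑ i, (z i : FormalRing n) • fun j => formalExtension (b i).1 (X j) := by
        funext j
        rw [hz, AddSubmonoidClass.coe_finsetSum, Finset.sum_apply]
        refine sum_congr rfl fun i _ => ?_
        rw [Pi.smul_apply, formalExtension_X, Subalgebra.coe_mul, smul_eq_mul]
      rw [this]
      exact Submodule.sum_mem _ fun i _ =>
        Submodule.smul_mem _ _ (Submodule.subset_span ⟨i, rfl⟩)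
    obtain ⟨a, ha⟩ := (Submodule.mem_span_range_iff_exists_fun _).1 key
    refine (Submodule.mem_span_range_iff_exists_fun _).2 ⟨a, derivation_formal_ext fun j => ?_⟩
    rw [derivation_sum_smul_apply]
    have := congrFun ha j
    rw [Finset.sum_apply] at this
    exact this

theorem associated_det_saitoMatrix_formalExtension {n : ℕ} {f : ConvergentRing n}
    (hf : Squarefree f) (b : Module.Basis (Fin n) (ConvergentRing n) (logDer f)) :
    Associated (f : FormalRing n) (saitoMatrix fun i => formalExtension (b i).1).det := by
  have h1 : saitoMatrix (fun i => formalExtension (b i).1) =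
      (ConvergentRing n).val.toRingHom.mapMatrix (convergentSaitoMatrix fun i => (b i).1) := by
    ext i j
    rw [saitoMatrix, Matrix.of_apply, formalExtension_X]
    rfl
  rw [h1, ← RingHom.map_det]
  exact (associated_det_convergentSaitoMatrix hf b).map (ConvergentRing n).val.toRingHom

/-- The extension of a singular logarithmic derivation is singular. -/
theorem constantCoeff_formalExtension_X {n : ℕ} {f : ConvergentRing n}
    (hsing : logDer f ≤ convergentMaxIdeal n •
      (⊤ : Submodule (ConvergentRing n) (Derivation ℂ (ConvergentRing n) (ConvergentRing n))))
    {D : Derivation ℂ (ConvergentRing n) (ConvergentRing n)} (hD : D ∈ logDer f) (j : Fin n) :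
    constantCoeff (formalExtension D (X j)) = 0 := by
  have h1 : D (convergentX j) ∈ convergentMaxIdeal n ^ 1 := by
    rw [pow_one]
    refine Submodule.smul_induction_on (hsing hD) (fun a ha E _ => ?_) fun E E' hE hE' => ?_
    · rw [Derivation.smul_apply]
      exact Ideal.mul_mem_right _ _ ha
    · rw [Derivation.add_apply]
      exact Ideal.add_mem _ hE hE'
  rw [formalExtension_X, ← coeff_zero_eq_constantCoeff_apply]
  exact mem_convergentMaxIdeal_pow.1 h1 0 (by simp)

/-! ### The Jordan decomposition of a derivation of a finite dimensional algebra -/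

theorem map_aeval_of_intertwining {M M' : Type*} [AddCommGroup M] [Module ℂ M] [AddCommGroup M']
    [Module ℂ M'] (π : M →ₗ[ℂ] M') {A : Module.End ℂ M} {B : Module.End ℂ M'}
    (h : ∀ m, π (A m) = B (π m)) (p : Polynomial ℂ) (m : M) :
    π (Polynomial.aeval A p m) = Polynomial.aeval B p (π m) := by
  induction p using Polynomial.induction_on generalizing m with
  | C a => simp
  | add p q hp hq => simp [hp, hq]
  | monomial k a ih =>
    rw [pow_succ, ← mul_assoc, map_mul (Polynomial.aeval A), map_mul (Polynomial.aeval B),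
      Polynomial.aeval_X, Polynomial.aeval_X, Module.End.mul_apply, ih, h, Module.End.mul_apply]

/-- The product of generalized eigenvectors of a derivation is a generalized eigenvector for the
sum of the eigenvalues. -/
theorem mul_mem_maxGenEigenspace {V : Type*} [CommRing V] [Algebra ℂ V] (D : Derivation ℂ V V)
    {a b : ℂ} {x y : V} (hx : x ∈ Module.End.maxGenEigenspace (D : V →ₗ[ℂ] V) a)
    (hy : y ∈ Module.End.maxGenEigenspace (D : V →ₗ[ℂ] V) b) :
    x * y ∈ Module.End.maxGenEigenspace (D : V →ₗ[ℂ] V) (a + b) := by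
  rw [Module.End.mem_maxGenEigenspace] at hx hy ⊢
  obtain ⟨i, hi⟩ := hx
  obtain ⟨j, hj⟩ := hy
  refine ⟨i + j, ?_⟩
  generalize hN : i + j = N
  induction N generalizing i j x y with
  | zero =>
    obtain rfl : i = 0 := by omega
    rw [pow_zero, Module.End.one_apply] at hi
    rw [hi, zero_mul, map_zero]
  | succ N ih =>
    have hstep : (((D : V →ₗ[ℂ] V) : Module.End ℂ V) - (a + b) • 1) (x * y) =
        (((D : V →ₗ[ℂ] V) : Module.End ℂ V) - a • 1) x * y +
          x * (((D : V →ₗ[ℂ] V) : Module.End ℂ V) - b • 1) y := by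
      simp only [LinearMap.sub_apply, LinearMap.smul_apply, Module.End.one_apply,
        Derivation.coeFn_coe, Derivation.leibniz, smul_eq_mul]
      simp only [Algebra.smul_def, map_add]
      ring
    rw [pow_succ, Module.End.mul_apply, hstep, map_add]
    have h1 : ((((D : V →ₗ[ℂ] V) : Module.End ℂ V) - (a + b) • 1) ^ N)
        ((((D : V →ₗ[ℂ] V) : Module.End ℂ V) - a • 1) x * y) = 0 := by
      cases i with
      | zero =>
        rw [pow_zero, Module.End.one_apply] at hi
        rw [hi, map_zero, zero_mul, map_zero]
      | succ i => exact ih i (by rwa [pow_succ, Module.End.mul_apply] at hi) j hj (by omega)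
    have h2 : ((((D : V →ₗ[ℂ] V) : Module.End ℂ V) - (a + b) • 1) ^ N)
        (x * (((D : V →ₗ[ℂ] V) : Module.End ℂ V) - b • 1) y) = 0 := by
      cases j with
      | zero =>
        rw [pow_zero, Module.End.one_apply] at hj
        rw [hj, map_zero, mul_zero, map_zero]
      | succ j => exact ih i hi j (by rwa [pow_succ, Module.End.mul_apply] at hj) (by omega)
    rw [h1, h2, add_zero]

/-- The semisimple part of a derivation is a derivation, since it acts on each generalized
eigenspace as multiplication by the eigenvalue. -/
theorem semisimplePart_leibniz {V : Type*} [CommRing V] [Algebra ℂ V] [FiniteDimensional ℂ V]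
    (D : Derivation ℂ V V) {s : Module.End ℂ V} (hs : s.IsSemisimple)
    (hn : IsNilpotent (((D : V →ₗ[ℂ] V) : Module.End ℂ V) - s))
    (hc : Commute ((D : V →ₗ[ℂ] V) : Module.End ℂ V) s) (x y : V) :
    s (x * y) = x * s y + y * s x := by
  have heig : ∀ {a : ℂ} {x : V}, x ∈ Module.End.maxGenEigenspace (D : V →ₗ[ℂ] V) a →
      s x = a • x := fun hx =>
    Module.End.apply_eq_of_mem_of_comm_of_isFinitelySemisimple_of_isNil hx hc
      hs.isFinitelySemisimple hn
  have htop : ∀ z : V, z ∈ ⨆ a, Module.End.maxGenEigenspace (D : V →ₗ[ℂ] V) a := fun z => by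
    rw [Module.End.iSup_maxGenEigenspace_eq_top]
    trivial
  refine Submodule.iSup_induction _ (motive := fun x => s (x * y) = x * s y + y * s x) (htop x)
    (fun a x hx => ?_) (by simp) fun x x' hx hx' => ?_
  · refine Submodule.iSup_induction _ (motive := fun y => s (x * y) = x * s y + y * s x) (htop y)
      (fun b y hy => ?_) (by simp) fun y y' hy hy' => ?_
    · rw [heig (mul_mem_maxGenEigenspace D hx hy), heig hx, heig hy]
      simp only [Algebra.smul_def, map_add]
      ring
    · rw [mul_add, map_add, map_add, hy, hy']
      ring
  · rw [add_mul, map_add, map_add, hx, hx']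
    ring

theorem exists_polynomial_semisimplePart {V : Type*} [CommRing V] [Algebra ℂ V]
    [FiniteDimensional ℂ V] (T : Module.End ℂ V) :
    ∃ p : Polynomial ℂ, (Polynomial.aeval T p).IsSemisimple ∧
      IsNilpotent (T - Polynomial.aeval T p) := by
  obtain ⟨m, -, s, hs, hm, hss, hT⟩ := T.exists_isNilpotent_isSemisimple
  rw [Algebra.adjoin_singleton_eq_range_aeval] at hs
  obtain ⟨p, rfl⟩ := hs
  refine ⟨p, hss, ?_⟩
  have : T - Polynomial.aeval T p = m := sub_eq_of_eq_add hT
  rwa [this]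

theorem commute_aeval {V : Type*} [AddCommGroup V] [Module ℂ V] (T : Module.End ℂ V)
    (p : Polynomial ℂ) : Commute T (Polynomial.aeval T p) := by
  have := (Commute.all (Polynomial.X : Polynomial ℂ) p).map (Polynomial.aeval T)
  rwa [Polynomial.aeval_X] at this

/-! ### The Jordan decomposition of a singular formal derivation -/

/-- The projection of `ℂ[[x₁, …, xₙ]]` on the finite dimensional algebra of jets modulo the
`k`-th power of the maximal ideal. -/
noncomputable abbrev jet (n k : ℕ) : FormalRing n →ₐ[ℂ] FormalRing n ⧸ formalMaxIdeal n ^ k :=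
  Ideal.Quotient.mkₐ ℂ (formalMaxIdeal n ^ k)

theorem jet_surjective (n k : ℕ) : Function.Surjective (jet n k) :=
  Ideal.Quotient.mkₐ_surjective _ _

theorem jet_eq_zero {n k : ℕ} {g : FormalRing n} : jet n k g = 0 ↔ g ∈ formalMaxIdeal n ^ k := by
  rw [jet, Ideal.Quotient.mkₐ_eq_mk, Ideal.Quotient.eq_zero_iff_mem]

theorem jet_eq_jet {n k : ℕ} {g h : FormalRing n} :
    jet n k g = jet n k h ↔ g - h ∈ formalMaxIdeal n ^ k := by
  rw [← sub_eq_zero, ← map_sub, jet_eq_zero]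

theorem formalMaxIdeal_pow_anti {n j k : ℕ} (h : j ≤ k) :
    formalMaxIdeal n ^ k ≤ formalMaxIdeal n ^ j := Ideal.pow_le_pow_right h

instance finiteDimensional_jets (n k : ℕ) :
    FiniteDimensional ℂ (FormalRing n ⧸ formalMaxIdeal n ^ k) := by
  classical
  have : Finite {d : Fin n →₀ ℕ // d.degree < k} := (Finsupp.finite_of_degree_lt k).to_subtype
  let φ : ({d : Fin n →₀ ℕ // d.degree < k} → ℂ) →ₗ[ℂ] FormalRing n :=
    { toFun := fun c d => if h : d.degree < k then c ⟨d, h⟩ else 0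
      map_add' := fun c c' => by
        funext d
        change _ = (if h : d.degree < k then c ⟨d, h⟩ else 0) +
          (if h : d.degree < k then c' ⟨d, h⟩ else 0)
        split_ifs <;> simp
      map_smul' := fun a c => by
        funext d
        change _ = a • (if h : d.degree < k then c ⟨d, h⟩ else 0)
        split_ifs <;> simp }
  refine Module.Finite.of_surjective ((jet n k).toLinearMap ∘ₗ φ) fun v => ?_
  obtain ⟨g, rfl⟩ := jet_surjective n k v
  refine ⟨fun d => coeff d.1 g, ?_⟩
  rw [LinearMap.comp_apply, AlgHom.toLinearMap_apply, jet_eq_jet, mem_formalMaxIdeal_pow]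
  intro d hd
  have : coeff d (φ fun d => coeff d.1 g) = coeff d g := by
    rw [coeff_apply]
    exact dif_pos hd
  rw [map_sub, this, sub_self]

/-- A derivation of formal power series is singular if it maps the coordinates to series without
constant term; it then preserves the powers of the maximal ideal. -/
theorem isFiltered_of_singular {n : ℕ} (D : Derivation ℂ (FormalRing n) (FormalRing n))
    (hD : ∀ j, constantCoeff (D (X j)) = 0) : IsFiltered (D : FormalRing n →ₗ[ℂ] FormalRing n) := by
  have h1 : ∀ g, D g ∈ formalMaxIdeal n := by
    intro g
    rw [formalDerivation_apply]
    refine Ideal.sum_mem _ fun j _ => Ideal.mul_mem_right _ _ ?_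
    have := mem_formalMaxIdeal_pow (k := 1).2 (coeff_eq_zero_of_degree_lt_one (hD j))
    rwa [pow_one] at this
  intro k
  induction k with
  | zero => simp
  | succ k ih =>
    intro g hg
    rw [pow_succ] at hg
    refine Submodule.mul_induction_on hg (fun a ha b hb => ?_) fun a b ha hb => ?_
    · rw [Derivation.coeFn_coe, Derivation.leibniz, smul_eq_mul, smul_eq_mul]
      refine Ideal.add_mem _ ?_ ?_
      · rw [pow_succ]
        exact Ideal.mul_mem_mul ha (h1 b)
      · rw [pow_succ']
        exact Ideal.mul_mem_mul hb (ih a ha)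
    · rw [map_add]
      exact Ideal.add_mem _ ha hb

theorem aeval_mem_of_forall_mem {M : Type*} [AddCommGroup M] [Module ℂ M] {T : Module.End ℂ M}
    {N : Submodule ℂ M} (hT : ∀ m ∈ N, T m ∈ N) (p : Polynomial ℂ) {m : M} (hm : m ∈ N) :
    Polynomial.aeval T p m ∈ N := by
  induction p using Polynomial.induction_on generalizing m with
  | C a => simpa using N.smul_mem a hm
  | add p q hp hq =>
    rw [map_add, LinearMap.add_apply]
    exact N.add_mem (hp hm) (hq hm)
  | monomial k a ih =>
    rw [pow_succ, ← mul_assoc, map_mul, Polynomial.aeval_X, Module.End.mul_apply]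
    exact ih (hT m hm)

/-- The Jordan decomposition of a singular formal derivation `D`: a derivation `S` that agrees
modulo each power of the maximal ideal with a polynomial in `D` and satisfies there a separable
polynomial equation, while `D - S` is nilpotent modulo each power of the maximal ideal. -/
theorem exists_formal_jordan {n : ℕ} (D : Derivation ℂ (FormalRing n) (FormalRing n))
    (hD : IsFiltered (D : FormalRing n →ₗ[ℂ] FormalRing n)) :
    ∃ S : Derivation ℂ (FormalRing n) (FormalRing n),
      (∀ k, ∃ p : Polynomial ℂ, ∀ g, S g - Polynomial.aeval
        ((D : FormalRing n →ₗ[ℂ] FormalRing n) : Module.End ℂ (FormalRing n)) p g ∈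
          formalMaxIdeal n ^ k) ∧
      (∀ k, ∃ Q : Polynomial ℂ, Squarefree Q ∧ ∀ g, Polynomial.aeval
        ((S : FormalRing n →ₗ[ℂ] FormalRing n) : Module.End ℂ (FormalRing n)) Q g ∈
          formalMaxIdeal n ^ k) ∧
      ∀ k, ∃ r : ℕ, ∀ g,
        ((((D - S : Derivation ℂ (FormalRing n) (FormalRing n)) :
          FormalRing n →ₗ[ℂ] FormalRing n) : Module.End ℂ (FormalRing n)) ^ r) g ∈
            formalMaxIdeal n ^ k := by
  set T : Module.End ℂ (FormalRing n) := (D : FormalRing n →ₗ[ℂ] FormalRing n) with hT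
  let DV (k : ℕ) : Derivation ℂ (FormalRing n ⧸ formalMaxIdeal n ^ k)
      (FormalRing n ⧸ formalMaxIdeal n ^ k) :=
    Derivation.liftOfSurjective (jet_surjective n k) (d := D)
      fun g hg => jet_eq_zero.2 (hD k g (jet_eq_zero.1 hg))
  let TV (k : ℕ) : Module.End ℂ (FormalRing n ⧸ formalMaxIdeal n ^ k) :=
    (DV k : (FormalRing n ⧸ formalMaxIdeal n ^ k) →ₗ[ℂ] (FormalRing n ⧸ formalMaxIdeal n ^ k))
  have hTV : ∀ k g, jet n k (T g) = TV k (jet n k g) := fun k g =>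
    (Derivation.liftOfSurjective_apply (jet_surjective n k) _ g).symm
  choose p hps hpn using fun k => exists_polynomial_semisimplePart (TV k)
  have hpV : ∀ j k g, jet n j (Polynomial.aeval T (p k) g) =
      Polynomial.aeval (TV j) (p k) (jet n j g) := fun j k g =>
    map_aeval_of_intertwining (jet n j).toLinearMap (hTV j) (p k) g
  -- The polynomials chosen for different jets induce the same semisimple parts.
  have hcompat : ∀ j k, j ≤ k → Polynomial.aeval (TV j) (p k) = Polynomial.aeval (TV j) (p j) := by
    intro j k hjk
    have hss : (Polynomial.aeval (TV j) (p k)).IsSemisimple := by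
      refine Module.End.isSemisimple_of_squarefree_aeval_eq_zero (hps k).minpoly_squarefree ?_
      refine LinearMap.ext fun v => ?_
      obtain ⟨g, rfl⟩ := jet_surjective n j v
      have h1 := map_aeval_of_intertwining (jet n j).toLinearMap (hpV j k)
        (minpoly ℂ (Polynomial.aeval (TV k) (p k))) g
      have h2 := map_aeval_of_intertwining (jet n k).toLinearMap (hpV k k)
        (minpoly ℂ (Polynomial.aeval (TV k) (p k))) g
      rw [minpoly.aeval, LinearMap.zero_apply] at h2
      rw [LinearMap.zero_apply]
      refine h1.symm.trans (jet_eq_zero.2 ?_)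
      exact formalMaxIdeal_pow_anti hjk (jet_eq_zero.1 h2)
    have hnil : IsNilpotent (TV j - Polynomial.aeval (TV j) (p k)) := by
      obtain ⟨r, hr⟩ := hpn k
      refine ⟨r, LinearMap.ext fun v => ?_⟩
      obtain ⟨g, rfl⟩ := jet_surjective n j v
      have key : ∀ l, jet n l (((T - Polynomial.aeval T (p k)) ^ r) g) =
          ((TV l - Polynomial.aeval (TV l) (p k)) ^ r) (jet n l g) := by
        intro l
        have := map_aeval_of_intertwining (jet n l).toLinearMap
          (A := T - Polynomial.aeval T (p k)) (B := TV l - Polynomial.aeval (TV l) (p k))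
          (fun m => by
            simp only [AlgHom.toLinearMap_apply, LinearMap.sub_apply, map_sub, hTV, hpV])
          (Polynomial.X ^ r) g
        simpa using this
      have h2 := key k
      rw [hr, LinearMap.zero_apply] at h2
      rw [LinearMap.zero_apply, ← key j]
      exact jet_eq_zero.2 (formalMaxIdeal_pow_anti hjk (jet_eq_zero.1 h2))
    refine (Module.End.isNilpotent_isSemisimple_unique hnil hss (hpn j) (hps j)
      ?_ ?_ (by rw [sub_add_cancel, sub_add_cancel])).2
    · exact Commute.sub_left (commute_aeval _ _) (Commute.refl _)
    · exact Commute.sub_left (commute_aeval _ _) (Commute.refl _)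
  -- The coefficients of `S g` are read off from the jets of sufficiently high order.
  let S₀ : Module.End ℂ (FormalRing n) :=
    { toFun := fun g d => coeff d (Polynomial.aeval T (p (d.degree + 1)) g)
      map_add' := fun g h => by
        funext d
        rw [map_add, map_add]
        rfl
      map_smul' := fun a g => by
        funext d
        rw [map_smul, map_smul]
        rfl }
  have hS₀ : ∀ g d, coeff d (S₀ g) = coeff d (Polynomial.aeval T (p (d.degree + 1)) g) :=
    fun g d => rfl
  have hSp : ∀ k g, S₀ g - Polynomial.aeval T (p k) g ∈ formalMaxIdeal n ^ k := by
    intro k g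
    rw [mem_formalMaxIdeal_pow]
    intro d hd
    have h1 : jet n (d.degree + 1) (Polynomial.aeval T (p k) g) =
        jet n (d.degree + 1) (Polynomial.aeval T (p (d.degree + 1)) g) := by
      rw [hpV, hpV, hcompat _ _ hd]
    have h2 := mem_formalMaxIdeal_pow.1 (jet_eq_jet.1 h1) d (by omega)
    rw [map_sub, sub_eq_zero] at h2
    rw [map_sub, hS₀, h2, sub_self]
  have hSV : ∀ k g, jet n k (S₀ g) = Polynomial.aeval (TV k) (p k) (jet n k g) := by
    intro k g
    rw [← hpV, jet_eq_jet]
    exact hSp k g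
  have hleib : ∀ g h, S₀ (g * h) = g • S₀ h + h • S₀ g := by
    intro g h
    rw [← sub_eq_zero]
    refine eq_zero_of_forall_mem_formalMaxIdeal_pow fun k => ?_
    rw [← jet_eq_zero, map_sub, map_add, smul_eq_mul, smul_eq_mul, hSV,
      map_mul (jet n k), map_mul (jet n k), map_mul (jet n k), hSV, hSV, sub_eq_zero]
    exact semisimplePart_leibniz (DV k) (hps k) (hpn k) (commute_aeval _ _) _ _
  refine ⟨Derivation.mk' S₀ hleib, fun k => ⟨p k, hSp k⟩, fun k => ?_, fun k => ?_⟩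
  · refine ⟨_, (hps k).minpoly_squarefree, fun g => ?_⟩
    have := map_aeval_of_intertwining (jet n k).toLinearMap (A := S₀) (hSV k)
      (minpoly ℂ (Polynomial.aeval (TV k) (p k))) g
    rw [minpoly.aeval, LinearMap.zero_apply] at this
    exact jet_eq_zero.1 this
  · obtain ⟨r, hr⟩ := hpn k
    refine ⟨r, fun g => ?_⟩
    have := map_aeval_of_intertwining (jet n k).toLinearMap
      (A := T - S₀) (B := TV k - Polynomial.aeval (TV k) (p k))
      (fun m => by
        simp only [AlgHom.toLinearMap_apply, LinearMap.sub_apply, map_sub, hTV, hSV])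
      (Polynomial.X ^ r) g
    rw [map_pow, map_pow, Polynomial.aeval_X, Polynomial.aeval_X, hr, LinearMap.zero_apply] at this
    exact jet_eq_zero.1 this

/-! ### Semisimplicity through the continuous dual -/

/-- An endomorphism is semisimple as soon as the space is a sum of stable subspaces on each of
which it satisfies a separable polynomial equation. -/
theorem isSemisimple_of_iSup_eq_top {M ι : Type*} [AddCommGroup M] [Module ℂ M]
    (T : Module.End ℂ M) (p : ι → Submodule ℂ M) (hp : ⨆ i, p i = ⊤)
    (hT : ∀ i, ∀ m ∈ p i, T m ∈ p i)
    (hQ : ∀ i, ∃ Q : Polynomial ℂ, Squarefree Q ∧ ∀ m ∈ p i, Polynomial.aeval T Q m = 0) :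
    T.IsSemisimple := by
  have hinv : ∀ i, p i ∈ T.invtSubmodule := hT
  rw [Module.End.IsSemisimple]
  refine isSemisimpleModule_of_isSemisimpleModule_submodule'
    (p := fun i => Module.AEval.mapSubmodule ℂ M T ⟨p i, hinv i⟩) (fun i => ?_) ?_
  · obtain ⟨Q, hQ, hQ0⟩ := hQ i
    have h : Module.End.IsSemisimple (LinearMap.restrict T (hT i)) := by
      refine Module.End.isSemisimple_of_squarefree_aeval_eq_zero hQ (LinearMap.ext fun m => ?_)
      refine Subtype.ext ?_
      rw [LinearMap.zero_apply, Submodule.coe_zero, ← hQ0 m m.2]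
      exact map_aeval_of_intertwining (p i).subtype (fun _ => rfl) Q m
    exact (Module.AEval.restrict_equiv_mapSubmodule T (p i) (hinv i)).isSemisimpleModule_iff.1 h
  · rw [eq_top_iff]
    intro m _
    have hm : (Module.AEval.of ℂ M T).symm m ∈ ⨆ i, p i := by
      rw [hp]
      trivial
    refine Submodule.iSup_induction p (motive := fun x => Module.AEval.of ℂ M T x ∈
      ⨆ i, Module.AEval.mapSubmodule ℂ M T ⟨p i, hinv i⟩) hm (fun i x hx => ?_) ?_
      fun x y hx hy => ?_
    · refine Submodule.mem_iSup_of_mem i ?_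
      rw [Module.AEval.mem_mapSubmodule_apply]
      simpa using hx
    · rw [map_zero]
      exact Submodule.zero_mem _
    · rw [map_add]
      exact Submodule.add_mem _ hx hy

/-- The linear forms on `ℂ[[x₁, …, xₙ]]` that are continuous for the `𝔪`-adic topology, that is,
those that vanish on some power of the maximal ideal. -/
noncomputable def continuousDual (n : ℕ) : Submodule ℂ (Module.Dual ℂ (FormalRing n)) where
  carrier := {φ | ∃ k, ∀ g ∈ formalMaxIdeal n ^ k, φ g = 0}
  add_mem' := by
    rintro φ ψ ⟨j, hφ⟩ ⟨k, hψ⟩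
    refine ⟨max j k, fun g hg => ?_⟩
    rw [LinearMap.add_apply, hφ g (formalMaxIdeal_pow_anti (le_max_left j k) hg),
      hψ g (formalMaxIdeal_pow_anti (le_max_right j k) hg), add_zero]
  zero_mem' := ⟨0, fun _ _ => rfl⟩
  smul_mem' := by
    rintro a φ ⟨k, hφ⟩
    refine ⟨k, fun g hg => ?_⟩
    rw [LinearMap.smul_apply, hφ g hg, smul_zero]

/-- The coefficient of `x ^ d`, as a continuous linear form. -/
noncomputable def coeffForm {n : ℕ} (d : Fin n →₀ ℕ) : continuousDual n :=
  ⟨coeff d, d.degree + 1, fun _ hg => mem_formalMaxIdeal_pow.1 hg d (by omega)⟩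

/-- The transpose of a filtered endomorphism, acting on the continuous linear forms. -/
noncomputable def transposeMap {n : ℕ} (T : Module.End ℂ (FormalRing n)) (hT : IsFiltered T) :
    Module.End ℂ (continuousDual n) where
  toFun φ := ⟨φ.1 ∘ₗ T, by
    obtain ⟨k, hk⟩ := φ.2
    exact ⟨k, fun g hg => hk _ (hT k g hg)⟩⟩
  map_add' _ _ := rfl
  map_smul' _ _ := rfl

theorem transposeMap_apply {n : ℕ} (T : Module.End ℂ (FormalRing n)) (hT : IsFiltered T)
    (φ : continuousDual n) (g : FormalRing n) : (transposeMap T hT φ).1 g = φ.1 (T g) := rfl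

theorem aeval_transposeMap_apply {n : ℕ} (T : Module.End ℂ (FormalRing n)) (hT : IsFiltered T)
    (p : Polynomial ℂ) (φ : continuousDual n) (g : FormalRing n) :
    (Polynomial.aeval (transposeMap T hT) p φ).1 g = φ.1 (Polynomial.aeval T p g) := by
  induction p using Polynomial.induction_on generalizing φ g with
  | C a => simp
  | add p q hp hq => simp [hp, hq]
  | monomial k a ih =>
    rw [pow_succ, ← mul_assoc, map_mul (Polynomial.aeval (transposeMap T hT)),
      mul_comm _ Polynomial.X, map_mul (Polynomial.aeval T), Polynomial.aeval_X,
      Polynomial.aeval_X, Module.End.mul_apply, Module.End.mul_apply, ih, transposeMap_apply]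

/-- The transpose of an endomorphism that satisfies a separable polynomial equation modulo each
power of the maximal ideal is semisimple. -/
theorem isSemisimple_transposeMap {n : ℕ} (T : Module.End ℂ (FormalRing n)) (hT : IsFiltered T)
    (hQ : ∀ k, ∃ Q : Polynomial ℂ, Squarefree Q ∧
      ∀ g, Polynomial.aeval T Q g ∈ formalMaxIdeal n ^ k) :
    (transposeMap T hT).IsSemisimple := by
  let p (k : ℕ) : Submodule ℂ (continuousDual n) :=
    { carrier := {φ | ∀ g ∈ formalMaxIdeal n ^ k, φ.1 g = 0}
      add_mem' := fun {φ ψ} hφ hψ g hg => by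
        change φ.1 g + ψ.1 g = 0
        rw [hφ g hg, hψ g hg, add_zero]
      zero_mem' := fun _ _ => rfl
      smul_mem' := fun a φ hφ g hg => by
        change a • φ.1 g = 0
        rw [hφ g hg, smul_zero] }
  refine isSemisimple_of_iSup_eq_top _ p ?_ (fun k φ hφ g hg => hφ _ (hT k g hg)) fun k => ?_
  · rw [eq_top_iff]
    intro φ _
    obtain ⟨k, hk⟩ := φ.2
    exact Submodule.mem_iSup_of_mem k hk
  · obtain ⟨Q, hQ, hQm⟩ := hQ k
    refine ⟨Q, hQ, fun φ hφ => Subtype.ext (LinearMap.ext fun g => ?_)⟩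
    rw [aeval_transposeMap_apply]
    exact hφ _ (hQm g)

theorem continuousDual_apply_eq_sum {n k : ℕ} {φ : Module.Dual ℂ (FormalRing n)}
    (hφ : ∀ g ∈ formalMaxIdeal n ^ k, φ g = 0) (g : FormalRing n) :
    φ g = ∑ d ∈ (Finsupp.finite_of_degree_lt (σ := Fin n) k).toFinset,
      φ (monomial d 1) * coeff d g := by
  classical
  have h : g - ∑ d ∈ (Finsupp.finite_of_degree_lt (σ := Fin n) k).toFinset,
      coeff d g • (monomial d 1 : FormalRing n) ∈ formalMaxIdeal n ^ k := by
    rw [mem_formalMaxIdeal_pow]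
    intro e he
    rw [map_sub, map_sum, Finset.sum_eq_single e]
    · simp
    · intro d _ hd
      rw [map_smul, coeff_monomial_ne hd.symm, smul_zero]
    · intro h
      exact absurd ((Set.Finite.mem_toFinset (Finsupp.finite_of_degree_lt k)).2 he) h
  have := hφ _ h
  rw [map_sub, map_sum, sub_eq_zero] at this
  rw [this]
  refine Finset.sum_congr rfl fun d _ => ?_
  rw [map_smul, smul_eq_mul, mul_comm]

/-- Hahn–Banach for the `𝔪`-adic topology: a closed subspace is cut out by continuous linear
forms. -/
theorem mem_of_forall_continuousDual {n : ℕ} {H : Submodule ℂ (FormalRing n)}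
    (hH : @IsClosed (FormalRing n) (formalMaxIdeal n).adicTopology (H : Set (FormalRing n)))
    {g : FormalRing n} (hg : ∀ φ ∈ continuousDual n, (∀ h ∈ H, φ h = 0) → φ g = 0) : g ∈ H := by
  let _ := (formalMaxIdeal n).adicTopology
  change g ∈ (H : Set (FormalRing n))
  rw [← hH.closure_eq, mem_closure_iff_nhds_basis ((formalMaxIdeal n).hasBasis_nhds_adic g)]
  intro k _
  by_contra hcon
  have hnot : g ∉ H ⊔ (formalMaxIdeal n ^ k).restrictScalars ℂ := by
    intro hmem
    obtain ⟨h, hh, m, hm, rfl⟩ := Submodule.mem_sup.1 hmem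
    refine hcon ⟨h, hh, -m, ?_, by ring⟩
    exact neg_mem (S := Ideal (FormalRing n)) hm
  obtain ⟨φ, hφg, hφ⟩ := Submodule.exists_le_ker_of_notMem hnot
  refine hφg (hg φ ⟨k, fun m hm => ?_⟩ fun h hh => ?_)
  · exact hφ ((le_sup_right : (formalMaxIdeal n ^ k).restrictScalars ℂ ≤ _) hm)
  · exact hφ ((le_sup_left : H ≤ _) hh)

/-- An endomorphism whose transpose on the continuous dual is semisimple is semisimple: closed
stable subspaces correspond to stable subspaces of the continuous dual by orthogonality. -/
theorem isSemisimpleMap_of_transposeMap {n : ℕ} (T : Module.End ℂ (FormalRing n))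
    (hT : IsFiltered T) (hss : (transposeMap T hT).IsSemisimple) : IsSemisimpleMap T := by
  refine ⟨hT, fun H hH hTH => ?_⟩
  let A : Submodule ℂ (continuousDual n) :=
    { carrier := {φ | ∀ h ∈ H, φ.1 h = 0}
      add_mem' := fun {φ ψ} hφ hψ g hg => by
        change φ.1 g + ψ.1 g = 0
        rw [hφ g hg, hψ g hg, add_zero]
      zero_mem' := fun _ _ => rfl
      smul_mem' := fun a φ hφ g hg => by
        change a • φ.1 g = 0
        rw [hφ g hg, smul_zero] }
  obtain ⟨W, hW, hAW⟩ := Module.End.isSemisimple_iff.1 hss A fun φ hφ h hh => hφ _ (hTH h hh)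
  let H' : Submodule ℂ (FormalRing n) :=
    { carrier := {g | ∀ φ ∈ W, φ.1 g = 0}
      add_mem' := fun {g h} hg hh φ hφ => by rw [map_add, hg φ hφ, hh φ hφ, add_zero]
      zero_mem' := fun φ _ => map_zero _
      smul_mem' := fun a g hg φ hφ => by rw [map_smul, hg φ hφ, smul_zero] }
  refine ⟨H', IsCompl.of_eq ?_ ?_, fun g hg φ hφ => hg _ (hW hφ)⟩
  · rw [eq_bot_iff]
    rintro g ⟨hgH, hgH'⟩
    rw [Submodule.mem_bot]
    refine MvPowerSeries.ext fun d => ?_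
    have hd : coeffForm d ∈ A ⊔ W := by
      rw [hAW.sup_eq_top]
      trivial
    obtain ⟨φ, hφ, ψ, hψ, h⟩ := Submodule.mem_sup.1 hd
    have h1 : φ.1 g + ψ.1 g = coeff d g := congrArg (fun χ : continuousDual n => χ.1 g) h
    rw [← h1, hφ g hgH, hgH' ψ hψ, add_zero, map_zero]
  · rw [eq_top_iff]
    intro g _
    let π := W.projection A hAW.symm
    -- The component of `g` in `H` is the series representing the form `φ ↦ (π φ) g`, where `π`
    -- is the projection onto `W` along the orthogonal of `H`.
    let h : FormalRing n := fun d => (π (coeffForm d)).1 g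
    have hcoeff : ∀ d, coeff d h = (π (coeffForm d)).1 g := fun d => rfl
    have hφ : ∀ φ : continuousDual n, φ.1 h = (π φ).1 g := by
      intro φ
      obtain ⟨k, hk⟩ := φ.2
      have hsum : φ = ∑ d ∈ (Finsupp.finite_of_degree_lt (σ := Fin n) k).toFinset,
          φ.1 (monomial d 1) • coeffForm d := by
        refine Subtype.ext (LinearMap.ext fun g' => ?_)
        rw [continuousDual_apply_eq_sum hk]
        simp [coeffForm]
      have h2 : (π φ).1 g = ∑ d ∈ (Finsupp.finite_of_degree_lt (σ := Fin n) k).toFinset,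
          φ.1 (monomial d 1) * (π (coeffForm d)).1 g := by
        conv_lhs => rw [hsum, map_sum]
        simp
      rw [h2, continuousDual_apply_eq_sum hk]
      rfl
    have hH1 : h ∈ H := by
      refine mem_of_forall_continuousDual hH fun φ hφc hφH => ?_
      have hA : (⟨φ, hφc⟩ : continuousDual n) ∈ A := hφH
      have := hφ ⟨φ, hφc⟩
      rwa [(Submodule.projection_apply_eq_zero_iff hAW.symm).2 hA] at this
    have hH2 : g - h ∈ H' := by
      intro φ hφW
      have := hφ φ
      rw [Submodule.projection_apply_of_mem_left hAW.symm hφW] at this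
      rw [map_sub, this, sub_self]
    rw [show g = h + (g - h) by ring]
    exact Submodule.add_mem_sup hH1 hH2

/-! ### Jordan decomposition inside the logarithmic derivations -/

theorem IsFiltered.of_forall_exists_polynomial {n : ℕ} {T S : Module.End ℂ (FormalRing n)}
    (hT : IsFiltered T)
    (hS : ∀ k, ∃ p : Polynomial ℂ, ∀ g, S g - Polynomial.aeval T p g ∈ formalMaxIdeal n ^ k) :
    IsFiltered S := by
  intro k g hg
  obtain ⟨p, hp⟩ := hS k
  rw [← sub_add_cancel (S g) (Polynomial.aeval T p g)]
  exact Ideal.add_mem _ (hp g) (aeval_mem_of_forall_mem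
    (N := (formalMaxIdeal n ^ k).restrictScalars ℂ) (hT k) p hg)

/-- A derivation that is approximated by polynomials in a logarithmic derivation is
logarithmic, because principal ideals are closed. -/
theorem mem_logDer_of_forall_exists_polynomial {n : ℕ} {f : FormalRing n}
    {D S : Derivation ℂ (FormalRing n) (FormalRing n)} (hD : D ∈ logDer f)
    (hS : ∀ k, ∃ p : Polynomial ℂ, ∀ g, S g - Polynomial.aeval
      ((D : FormalRing n →ₗ[ℂ] FormalRing n) : Module.End ℂ (FormalRing n)) p g ∈
        formalMaxIdeal n ^ k) : S ∈ logDer f := by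
  have hstable : ∀ g ∈ (Ideal.span {f}).restrictScalars ℂ,
      ((D : FormalRing n →ₗ[ℂ] FormalRing n) : Module.End ℂ (FormalRing n)) g ∈
        (Ideal.span {f}).restrictScalars ℂ := by
    intro g hg
    obtain ⟨a, rfl⟩ := Ideal.mem_span_singleton'.1 hg
    change D (a * f) ∈ Ideal.span {f}
    rw [Derivation.leibniz, smul_eq_mul, smul_eq_mul]
    exact Ideal.add_mem _ (Ideal.mul_mem_left _ _ hD)
      (Ideal.mul_mem_right _ _ (Ideal.mem_span_singleton_self f))
  change S f ∈ Ideal.span {f}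
  refine mem_of_forall_exists_sub_mem (Ideal.span {f}) fun k => ?_
  obtain ⟨p, hp⟩ := hS k
  refine ⟨_, aeval_mem_of_forall_mem hstable p (Ideal.mem_span_singleton_self f), ?_⟩
  rw [smul_eq_mul, Ideal.mul_top]
  exact hp f

/-- A singular logarithmic derivation is the sum of a semisimple and of a nilpotent logarithmic
derivation. -/
theorem exists_semisimple_add_nilpotent {n : ℕ} {f : FormalRing n}
    {D : Derivation ℂ (FormalRing n) (FormalRing n)} (hD : D ∈ logDer f)
    (hsing : ∀ j, constantCoeff (D (X j)) = 0) :
    ∃ S ∈ logDer f, ∃ N ∈ logDer f, D = S + N ∧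
      IsSemisimpleMap (S : FormalRing n →ₗ[ℂ] FormalRing n) ∧
      IsTopNilpotentMap (N : FormalRing n →ₗ[ℂ] FormalRing n) := by
  have hDf := isFiltered_of_singular D hsing
  obtain ⟨S, hp, hQ, hN⟩ := exists_formal_jordan D hDf
  have hSf := hDf.of_forall_exists_polynomial hp
  have hS := mem_logDer_of_forall_exists_polynomial hD hp
  have hNf : IsFiltered ((D - S : Derivation ℂ (FormalRing n) (FormalRing n)) :
      FormalRing n →ₗ[ℂ] FormalRing n) :=
    fun k g hg => Ideal.sub_mem _ (hDf k g hg) (hSf k g hg)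
  refine ⟨S, hS, D - S, Submodule.sub_mem _ hD hS, (add_sub_cancel S D).symm,
    isSemisimpleMap_of_transposeMap _ hSf (isSemisimple_transposeMap _ hSf hQ), hNf,
    fun g k => ?_⟩
  obtain ⟨r, hr⟩ := hN k
  refine ⟨r, fun m hm => ?_⟩
  rw [← Nat.add_sub_cancel' hm, pow_add]
  exact hr _

/-! ### Bases of the formal logarithmic derivations -/

/-- By the lemma of Nakayama, a generating family of a free module over a local ring contains a
basis. -/
theorem exists_basis_of_span_eq_top_of_isLocalRing {R M ι : Type} [CommRing R] [IsLocalRing R]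
    [AddCommGroup M] [Module R M] {n : ℕ} (c : Module.Basis (Fin n) R M) (v : ι → M)
    (hv : Submodule.span R (Set.range v) = ⊤) :
    ∃ (a : Fin n → ι) (b : Module.Basis (Fin n) R M), ∀ i, b i = v (a i) := by
  have := Module.Free.of_basis c
  have := Module.Finite.of_basis c
  have : Module.FinitePresentation R M :=
    Module.finitePresentation_of_projective R M
  obtain ⟨κ, a, b, hb⟩ := Module.exists_basis_of_span_of_flat v hv
  let e : κ ≃ Fin n := b.indexEquiv c
  exact ⟨a ∘ e.symm, b.reindex e, fun i => by rw [Module.Basis.reindex_apply, hb]; rfl⟩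

/-- The Saito matrices of two bases of the same module of derivations have associated
determinants. -/
theorem associated_det_saitoMatrix_of_basis {n : ℕ}
    {L : Submodule (FormalRing n) (Derivation ℂ (FormalRing n) (FormalRing n))}
    (b c : Module.Basis (Fin n) (FormalRing n) L) :
    Associated (saitoMatrix fun i => (b i).1).det (saitoMatrix fun i => (c i).1).det := by
  have key : ∀ b c : Module.Basis (Fin n) (FormalRing n) L,
      (saitoMatrix fun i => (b i).1).det ∣ (saitoMatrix fun i => (c i).1).det := by
    intro b c
    have : (saitoMatrix fun i => (c i).1) =
        (Matrix.of fun i j => b.repr (c i) j) * saitoMatrix fun i => (b i).1 := by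
      ext1 i j
      have h : (c i).1 = ∑ l, b.repr (c i) l • (b l).1 := by
        conv_lhs => rw [← b.sum_repr (c i)]
        rw [AddSubmonoidClass.coe_finsetSum]
        rfl
      rw [Matrix.mul_apply]
      change (c i).1 (X j) = ∑ l, b.repr (c i) l * (b l).1 (X j)
      conv_lhs => rw [h]
      rw [derivation_sum_smul_apply]
    rw [this, Matrix.det_mul]
    exact dvd_mul_left _ _
  exact associated_of_dvd_dvd (key b c) (key c b)

theorem linearIndependent_of_det_saitoMatrix_ne_zero {n : ℕ}
    {δ : Fin n → Derivation ℂ (FormalRing n) (FormalRing n)} (h : (saitoMatrix δ).det ≠ 0) :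
    LinearIndependent (FormalRing n) δ := by
  rw [Fintype.linearIndependent_iff]
  intro a ha
  have : Matrix.vecMul a (saitoMatrix δ) = 0 := by
    funext j
    have h := DFunLike.congr_fun ha (X j)
    rw [derivation_sum_smul_apply] at h
    exact h
  exact congrFun (Matrix.eq_zero_of_vecMul_eq_zero h this)

end FreeDiv

theorem mainTheorem6 (n : ℕ) (f : FreeDiv.ConvergentRing n)
    (hfree : FreeDiv.IsFreeSeries f)
    (hsing : FreeDiv.logDer f ≤
      FreeDiv.convergentMaxIdeal n •
        (⊤ : Submodule (FreeDiv.ConvergentRing n)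
          (Derivation ℂ (FreeDiv.ConvergentRing n) (FreeDiv.ConvergentRing n)))) :
    ∃ b : Module.Basis (Fin n) (FreeDiv.FormalRing n)
        (FreeDiv.logDer (f : FreeDiv.FormalRing n)),
      (∀ i : Fin n,
        FreeDiv.IsSemisimpleMap
            ((b i : Derivation ℂ (FreeDiv.FormalRing n) (FreeDiv.FormalRing n)) :
              FreeDiv.FormalRing n →ₗ[ℂ] FreeDiv.FormalRing n) ∨
          FreeDiv.IsTopNilpotentMap
            ((b i : Derivation ℂ (FreeDiv.FormalRing n) (FreeDiv.FormalRing n)) :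
              FreeDiv.FormalRing n →ₗ[ℂ] FreeDiv.FormalRing n)) ∧
      ∃ u : (FreeDiv.FormalRing n)ˣ,
        (f : FreeDiv.FormalRing n) =
          (u : FreeDiv.FormalRing n) *
            (FreeDiv.saitoMatrix fun i =>
              (b i : Derivation ℂ (FreeDiv.FormalRing n) (FreeDiv.FormalRing n))).det := by
  obtain ⟨hf, hfr⟩ := hfree
  obtain ⟨b₀⟩ := FreeDiv.exists_basis_logDer hf.ne_zero
  have hspan := FreeDiv.span_formalExtension b₀
  have hdet := FreeDiv.associated_det_saitoMatrix_formalExtension hf b₀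
  set δ := fun i => FreeDiv.formalExtension (b₀ i).1 with hδ
  have hf0 : (f : FreeDiv.FormalRing n) ≠ 0 := fun h => hf.ne_zero (Subtype.ext h)
  have hli := FreeDiv.linearIndependent_of_det_saitoMatrix_ne_zero fun h =>
    hf0 (hdet.eq_zero_iff.2 h)
  let c : Module.Basis (Fin n) (FreeDiv.FormalRing n)
      (FreeDiv.logDer (f : FreeDiv.FormalRing n)) :=
    (Module.Basis.span hli).map (LinearEquiv.ofEq _ _ hspan)
  have hc : ∀ i, (c i).1 = δ i := fun i => by
    rw [Module.Basis.map_apply, LinearEquiv.coe_ofEq_apply, Module.Basis.span_apply]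
  choose S hS N hN hSN hss hnil using fun i => FreeDiv.exists_semisimple_add_nilpotent
    (hc i ▸ (c i).2) (FreeDiv.constantCoeff_formalExtension_X hsing (b₀ i).2)
  -- The semisimple and nilpotent parts together generate, so that they contain a basis.
  let v : Fin n ⊕ Fin n → FreeDiv.logDer (f : FreeDiv.FormalRing n) :=
    Sum.elim (fun i => ⟨S i, hS i⟩) fun i => ⟨N i, hN i⟩
  have hv : Submodule.span (FreeDiv.FormalRing n) (Set.range v) = ⊤ := by
    rw [eq_top_iff, ← c.span_eq, Submodule.span_le]
    rintro _ ⟨i, rfl⟩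
    have h : c i = v (Sum.inl i) + v (Sum.inr i) := Subtype.ext ((hc i).trans (hSN i))
    rw [h]
    exact Submodule.add_mem _ (Submodule.subset_span ⟨_, rfl⟩) (Submodule.subset_span ⟨_, rfl⟩)
  obtain ⟨a, b, hb⟩ := FreeDiv.exists_basis_of_span_eq_top_of_isLocalRing c v hv
  refine ⟨b, fun i => ?_, ?_⟩
  · rw [hb]
    rcases a i with j | j
    · exact Or.inl (hss j)
    · exact Or.inr (hnil j)
  · have h := FreeDiv.associated_det_saitoMatrix_of_basis b c
    simp only [hc] at h
    obtain ⟨u, hu⟩ := h.trans hdet.symm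
    exact ⟨u, hu.symm.trans (mul_comm _ _)⟩
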